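/- Let $x_l<x_r$, $L=x_r-x_l$, $T>0$, $M\in\mathbb R$. For $0<\beta<1$ let ${}^C_0D_t^\beta g(t)=\frac1{\Gamma(1-\beta)}\int_0^t\frac{g'(s)}{(t-s)^\beta}\,ds$ be the Caputo derivative. Let $0<\alpha<1$ and let $u\in C^{4,2}_{x,t}([x_l,x_r]\times[0,T])$ (the partial derivatives $\partial_x^ju$, $j\le 4$, and $\partial_t^ju$, $j\le 2$, exist and are continuous on the closed rectangle), with all these derivatives bounded by $M$ in absolute value, be a solution of $$\begin{aligned} &{}^C_0D_t^\alpha u=u_{xx}+f, && x_l<x<x_r,\ 0<t\le T,\\ &u(x,0)=u_0(x), && x_l<x<x_r,\\ &u_x(x_l,t)={}^C_0D_t^{\alpha/2}u(x_l,t),\quad u_x(x_r,t)=-{}^C_0D_t^{\alpha/2}u(x_r,t), && 0<t\le T, \end{aligned}$$ where $u_0$ and $f(\cdot,t)$, $0<t\le T$, are continuous on $[x_l,x_r]$. Let $N_T,N_S\ge1$ be integers, $\Delta t=T/N_T$, $t_n=n\Delta t$, $h=L/N_S$, $x_i=x_l+ih$. For $\beta\in\{\alpha,\alpha/2\}$ let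 $w_1^{(\beta)},\dots,w_{m_\beta}^{(\beta)}>0$ and $s_1^{(\beta)},\dots,s_{m_\beta}^{(\beta)}>0$ satisfy $$\Big|\,t^{-1-\beta}-\sum_{j=1}^{m_\beta}w_j^{(\beta)}e^{-s_j^{(\beta)}t}\Big|\le\varepsilon,\qquad \Delta t\le t\le T .$$ For a mesh function $(v^n)_{0\le n\le N_T}$ and $n\ge1$ the FIR approximation of the Caputo derivative of order $\beta$ is $$\mathbb D_t^\beta v^n=\frac{v^n-v^{n-1}}{\Delta t^\beta\,\Gamma(2-\beta)}+\frac1{\Gamma(1-\beta)}\Big[\frac{v^{n-1}}{\Delta t^\beta}-\frac{v^0}{t_n^\beta}-\beta\sum_{j=1}^{m_\beta}w_j^{(\beta)}V_j^n\Big],$$ where, with $s=s_j^{(\beta)}$, $V_j^1=0$ and, for $n\ge2$, $$V_j^n=e^{-s\Delta t}V_j^{n-1}+\frac{e^{-s\Delta t}}{s^2\Delta t}\Big[(e^{-s\Delta t}-1+s\Delta t)v^{n-1}+(1-e^{-s\Delta t}-e^{-s\Delta t}s\Delta t)v^{n-2}\Big].$$ Let $u_i^n$ ($0\le i\le N_S$,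 $0\le n\le N_T$) be a solution of the FIR difference scheme: $u_i^0=u_0(x_i)$ for all $i$ and, for $1\le n\le N_T$, $$\begin{aligned} \mathbb D_t^\alpha u_i^n&=\frac{u_{i+1}^n-2u_i^n+u_{i-1}^n}{h^2}+f(x_i,t_n)\qquad(1\le i\le N_S-1),\\ \mathbb D_t^\alpha u_0^n&=\frac2h\Big[\frac{u_1^n-u_0^n}h-\mathbb D_t^{\alpha/2}u_0^n\Big]+f(x_0,t_n),\\ \mathbb D_t^\alpha u_{N_S}^n&=\frac2h\Big[-\frac{u_{N_S}^n-u_{N_S-1}^n}h-\mathbb D_t^{\alpha/2}u_{N_S}^n\Big]+f(x_{N_S},t_n). \end{aligned}$$ Put $e_i^k=u_i^k-u(x_i,t_k)$, $\|e^k\|_\infty=\max_{0\le i\le N_S}|e_i^k|$ and $$\mu_n=\frac{t_n^{-\alpha}-2\alpha\varepsilon t_{n-1}}{\Gamma(1-\alpha)},\qquad \nu_n=\frac{t_n^{-\alpha/2}-\alpha\varepsilon t_{n-1}}{\Gamma(1-\alpha/2)}.$$ (1) There is a constant $c_1>0$ depending only on $x_l,x_r,T,M$ (in particular not on $\alpha$,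 $\varepsilon$, $u$, the grid or the sums of exponentials) such that for every $1\le n\le N_T$ with $\mu_n>0$ and $\nu_n>0$ $$\sqrt{\Delta t\sum_{k=1}^n\|e^k\|_\infty^2}\le c_2\big(\Delta t^{2-\alpha}+h^2+\alpha\varepsilon\big),\qquad c_2=\bigg(\frac{4c_1^2T\big(1+\sqrt{1+L^2\mu_n}\big)}{L\mu_n}\Big(\frac1{\nu_n}+\frac L{\mu_n}\Big)\bigg)^{1/2}>0 .$$ (2) For all $\mu_0,\nu_0>0$ there is a constant $c_2>0$ depending only on $x_l,x_r,T,M,\mu_0,\nu_0$ such that, whenever $\mu_{N_T}\ge\mu_0$ and $\nu_{N_T}\ge\nu_0$, the estimate $\sqrt{\Delta t\sum_{k=1}^n\|e^k\|_\infty^2}\le c_2(\Delta t^{2-\alpha}+h^2+\alpha\varepsilon)$ holds for all $1\le n\le N_T$. -/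

import Mathlib

noncomputable section

namespace FIR

/-- The `j`-th partial derivative in `x` on `[xl, xr]` (one-sided at the end points). -/
def pdx (xl xr : ℝ) (j : ℕ) (u : ℝ → ℝ → ℝ) (x t : ℝ) : ℝ :=
  iteratedDerivWithin j (fun y => u y t) (Set.Icc xl xr) x

/-- The `j`-th partial derivative in `t` on `[0, T]` (one-sided at the end points). -/
def pdt (T : ℝ) (j : ℕ) (u : ℝ → ℝ → ℝ) (x t : ℝ) : ℝ :=
  iteratedDerivWithin j (fun s => u x s) (Set.Icc 0 T) t

/-- `u ∈ C^{4,2}_{x,t}([xl, xr] × [0, T])`: the partial derivatives in `x` up to order `4` and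
in `t` up to order `2` exist and are jointly continuous on the closed rectangle. -/
structure IsC42 (xl xr T : ℝ) (u : ℝ → ℝ → ℝ) : Prop where
  contDiff_x : ∀ t ∈ Set.Icc 0 T, ContDiffOn ℝ 4 (fun x => u x t) (Set.Icc xl xr)
  contDiff_t : ∀ x ∈ Set.Icc xl xr, ContDiffOn ℝ 2 (fun t => u x t) (Set.Icc 0 T)
  continuous_x : ∀ j ≤ 4,
    ContinuousOn (fun p : ℝ × ℝ => pdx xl xr j u p.1 p.2) (Set.Icc xl xr ×ˢ Set.Icc 0 T)
  continuous_t : ∀ j ≤ 2,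
    ContinuousOn (fun p : ℝ × ℝ => pdt T j u p.1 p.2) (Set.Icc xl xr ×ˢ Set.Icc 0 T)

/-- All the derivatives that enter `C^{4,2}_{x,t}` are bounded by `M` on the rectangle
(by compactness every `u` in `C^{4,2}_{x,t}` has such an `M`). -/
def C42NormLE (xl xr T : ℝ) (u : ℝ → ℝ → ℝ) (M : ℝ) : Prop :=
  ∀ x ∈ Set.Icc xl xr, ∀ t ∈ Set.Icc 0 T,
    (∀ j ≤ 4, |pdx xl xr j u x t| ≤ M) ∧ (∀ j ≤ 2, |pdt T j u x t| ≤ M)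

/-- Caputo derivative of order `β ∈ (0, 1)`. -/
def caputo (β : ℝ) (g : ℝ → ℝ) (t : ℝ) : ℝ :=
  1 / Real.Gamma (1 - β) * ∫ s in (0 : ℝ)..t, deriv g s / (t - s) ^ β

/-- `u` solves the time-fractional diffusion problem on `(xl, xr) × (0, T]` with source `f`,
initial value `u₀` and the nonreflecting boundary conditions. The data `f`, `u₀`, which a
finite difference scheme samples at the end points too, are continuous up to the boundary. -/
structure IsSolution (xl xr T α : ℝ) (f : ℝ → ℝ → ℝ) (u₀ : ℝ → ℝ) (u : ℝ → ℝ → ℝ) :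
    Prop where
  source_continuous : ∀ t ∈ Set.Ioc 0 T, ContinuousOn (fun x => f x t) (Set.Icc xl xr)
  initial_continuous : ContinuousOn u₀ (Set.Icc xl xr)
  equation : ∀ x ∈ Set.Ioo xl xr, ∀ t ∈ Set.Ioc 0 T,
    caputo α (fun s => u x s) t = pdx xl xr 2 u x t + f x t
  initial : ∀ x ∈ Set.Ioo xl xr, u x 0 = u₀ x
  left_boundary : ∀ t ∈ Set.Ioc 0 T, pdx xl xr 1 u xl t = caputo (α / 2) (fun s => u xl s) t
  right_boundary : ∀ t ∈ Set.Ioc 0 T, pdx xl xr 1 u xr t = -caputo (α / 2) (fun s => u xr s) t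

/-- `∑ i, w i * exp (-(s i) t)`, with positive weights and nodes, approximates `t ^ (-1 - β)`
on `[δ, T]` with absolute error at most `ε`. -/
structure IsSumOfExp (β ε δ T : ℝ) {m : ℕ} (w s : Fin m → ℝ) : Prop where
  weight_pos : ∀ i, 0 < w i
  node_pos : ∀ i, 0 < s i
  error_le : ∀ t, δ ≤ t → t ≤ T → |1 / t ^ (1 + β) - ∑ i, w i * Real.exp (-(s i) * t)| ≤ ε

/-- The history mode with node `s` of a mesh function `v`. The history integral runs over
`[0, t_{n-1}]`, so that it vanishes at `n = 1` (the value at `n = 0` is never used). -/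
def histMode (dt s : ℝ) (v : ℕ → ℝ) : ℕ → ℝ
  | 0 => 0
  | 1 => 0
  | n + 2 =>
    Real.exp (-s * dt) * histMode dt s v (n + 1) +
      Real.exp (-s * dt) / (s ^ 2 * dt) *
        ((Real.exp (-s * dt) - 1 + s * dt) * v (n + 1) +
          (1 - Real.exp (-s * dt) - Real.exp (-s * dt) * s * dt) * v n)

/-- The FIR approximation of the Caputo derivative of order `β` at `t_n = n dt`, `n ≥ 1`. -/
def firDeriv (β dt : ℝ) {m : ℕ} (w s : Fin m → ℝ) (v : ℕ → ℝ) (n : ℕ) : ℝ :=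
  (v n - v (n - 1)) / (dt ^ β * Real.Gamma (2 - β)) +
    1 / Real.Gamma (1 - β) *
      (v (n - 1) / dt ^ β - v 0 / ((n : ℝ) * dt) ^ β - β * ∑ i, w i * histMode dt (s i) v n)

/-- `U i n` (`0 ≤ i ≤ NS`, `0 ≤ n ≤ NT`) is a solution of the FIR finite difference scheme, with
`(w, s)` the weights and nodes for order `α` and `(w', s')` those for order `α / 2`. -/
structure IsFIRSolution (xl α dt h : ℝ) (NT NS : ℕ) {m m' : ℕ} (w s : Fin m → ℝ)
    (w' s' : Fin m' → ℝ) (f : ℝ → ℝ → ℝ) (u₀ : ℝ → ℝ) (U : ℕ → ℕ → ℝ) : Prop where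
  interior : ∀ i n, 1 ≤ i → i + 1 ≤ NS → 1 ≤ n → n ≤ NT →
    firDeriv α dt w s (U i) n =
      ((U (i + 1) n - U i n) / h - (U i n - U (i - 1) n) / h) / h + f (xl + i * h) (n * dt)
  left : ∀ n, 1 ≤ n → n ≤ NT →
    firDeriv α dt w s (U 0) n =
      2 / h * ((U 1 n - U 0 n) / h - firDeriv (α / 2) dt w' s' (U 0) n) + f xl (n * dt)
  right : ∀ n, 1 ≤ n → n ≤ NT →
    firDeriv α dt w s (U NS) n =
      2 / h * (-((U NS n - U (NS - 1) n) / h) - firDeriv (α / 2) dt w' s' (U NS) n) +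
        f (xl + NS * h) (n * dt)
  initial : ∀ i, i ≤ NS → U i 0 = u₀ (xl + i * h)

/-- Everything that the error estimate is about: the order `α ∈ (0, 1)`, the exact solution
`u ∈ C^{4,2}_{x,t}` with derivatives bounded by `M`, the grid with `NT` time steps and `NS`
space steps, sums of exponentials for both orders `α` and `α / 2` with error at most `ε` on
`[dt, T]`, and the numerical solution `U`. -/
structure Setting (xl xr T M α ε : ℝ) (u : ℝ → ℝ → ℝ) (NT NS : ℕ) (U : ℕ → ℕ → ℝ) where
  f : ℝ → ℝ → ℝ
  u₀ : ℝ → ℝ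
  m : ℕ
  m' : ℕ
  w : Fin m → ℝ
  s : Fin m → ℝ
  w' : Fin m' → ℝ
  s' : Fin m' → ℝ
  order_pos : 0 < α
  order_lt_one : α < 1
  regular : IsC42 xl xr T u
  bounded : C42NormLE xl xr T u M
  solution : IsSolution xl xr T α f u₀ u
  time_steps_pos : 1 ≤ NT
  space_steps_pos : 1 ≤ NS
  sumOfExp : IsSumOfExp α ε (T / NT) T w s
  sumOfExp_half : IsSumOfExp (α / 2) ε (T / NT) T w' s'
  numerical : IsFIRSolution xl α (T / NT) ((xr - xl) / NS) NT NS w s w' s' f u₀ U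

/-- `(dt ∑_{k=1}^n ‖e^k‖_∞²)^{1/2}` for `e_i^k = U_i^k - u(x_i, t_k)`; the norm on
`Fin (NS + 1) → ℝ` is the maximum norm. -/
def globalError (xl dt h : ℝ) (NS : ℕ) (u : ℝ → ℝ → ℝ) (U : ℕ → ℕ → ℝ) (n : ℕ) : ℝ :=
  Real.sqrt (dt * ∑ k ∈ Finset.Icc 1 n,
    ‖fun i : Fin (NS + 1) => U i k - u (xl + (i : ℕ) * h) (k * dt)‖ ^ 2)

/-- `μ = (t_n^{-α} - 2 α ε t_{n-1}) / Γ(1 - α)`. -/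
def mu (α ε dt : ℝ) (n : ℕ) : ℝ :=
  (((n : ℝ) * dt) ^ (-α) - 2 * α * ε * (((n : ℝ) - 1) * dt)) / Real.Gamma (1 - α)

/-- `ν = (t_n^{-α/2} - α ε t_{n-1}) / Γ(1 - α/2)`. -/
def nu (α ε dt : ℝ) (n : ℕ) : ℝ :=
  (((n : ℝ) * dt) ^ (-(α / 2)) - α * ε * (((n : ℝ) - 1) * dt)) / Real.Gamma (1 - α / 2)

/-- The constant `c₂` as a function of `c₁`, `T`, `L`, `μ`, `ν`. -/
def errConst (c₁ T L μ ν : ℝ) : ℝ :=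
  Real.sqrt (4 * c₁ ^ 2 * T * (1 + Real.sqrt (1 + L ^ 2 * μ)) / (L * μ) * (1 / ν + L / μ))

end FIR

end

noncomputable section

namespace FIR

open MeasureTheory

/-! The proof is consistency plus stability in a discrete energy norm. The scheme is linear, so the
grid error satisfies it with truncation residuals as data and vanishes at time `0`.

Stability in time: on mesh functions that vanish initially, the FIR derivative is a lower triangular
Toeplitz operator with nonpositive off-diagonal entries (`firDeriv_eq_toeplitz`). The history
weights of a single exponential sum to at most its integral over `[dt, t_n]`. The weighted
exponentials replace `t ^ (-1 - β)` with error `ε`, so the diagonal dominates by `t_n ^ (-β) - β ε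
t_{n-1}`, up to `Γ(1 - β)`. Diagonal dominance gives coercivity (`firDeriv_coercive`); half of it or
more is what `mu` and `nu` measure.

Stability in space: multiply each equation by the error, use trapezoidal weights and sum by parts
(`energy_identity`). The boundary terms then contain the half-order derivative at the end points,
which `nu` controls. Young's inequality absorbs the residuals (`discrete_stability`), and a discrete
Sobolev inequality turns the energy into a maximum norm (`sobolev_energy`).

Consistency: the history modes are exact integrals of the piecewise linear interpolant, so only the
interpolation error and the kernel error `ε` remain (`TimeRegular.firDeriv_error`). The factor `β`
before the history cancels the `1 / β` from integrating the kernel, and `Γ(1 - β) ≥ 1`, `Γ(2 - β) ≥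
1/2`; this keeps the constants independent of `α`. In space, Taylor expansion gives order `h ^ 2`,
also at the boundary once its equations are multiplied by `h / 2`. -/

/-! ### Linearity and convolution form of the history modes. -/

lemma histMode_sub (dt s : ℝ) (v v' : ℕ → ℝ) (n : ℕ) :
    histMode dt s (fun k => v k - v' k) n = histMode dt s v n - histMode dt s v' n := by
  induction n using Nat.twoStepInduction with
  | zero => simp [histMode]
  | one => simp [histMode]
  | more n _ ih =>
    simp only [histMode] at ih ⊢
    rw [ih]
    ring

lemma firDeriv_sub (β dt : ℝ) {m : ℕ} (w s : Fin m → ℝ) (v v' : ℕ → ℝ) (n : ℕ) :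
    firDeriv β dt w s (fun k => v k - v' k) n =
      firDeriv β dt w s v n - firDeriv β dt w s v' n := by
  simp only [firDeriv, histMode_sub, mul_sub, Finset.sum_sub_distrib]
  ring

/-- The convolution weights of the history mode with node `s`. -/
def histWeight (dt s : ℝ) : ℕ → ℝ
  | 0 => Real.exp (-s * dt) / (s ^ 2 * dt) * (Real.exp (-s * dt) - 1 + s * dt)
  | 1 => Real.exp (-s * dt) *
        (Real.exp (-s * dt) / (s ^ 2 * dt) * (Real.exp (-s * dt) - 1 + s * dt)) +
      Real.exp (-s * dt) / (s ^ 2 * dt) *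
        (1 - Real.exp (-s * dt) - Real.exp (-s * dt) * s * dt)
  | i + 2 => Real.exp (-s * dt) * histWeight dt s (i + 1)

lemma histWeight_succ (dt s : ℝ) (i : ℕ) :
    histWeight dt s (i + 1) = Real.exp (-s * dt) * histWeight dt s i +
      if i = 0 then Real.exp (-s * dt) / (s ^ 2 * dt) *
        (1 - Real.exp (-s * dt) - Real.exp (-s * dt) * s * dt) else 0 := by
  cases i <;> simp [histWeight]

lemma exp_moment_nonneg {dt s : ℝ} :
    0 ≤ 1 - Real.exp (-s * dt) - Real.exp (-s * dt) * s * dt := by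
  have h1 : s * dt + 1 ≤ Real.exp (s * dt) := Real.add_one_le_exp _
  have h2 : Real.exp (-s * dt) * Real.exp (s * dt) = 1 := by
    rw [← Real.exp_add]; simp
  have h3 := mul_le_mul_of_nonneg_left h1 (Real.exp_pos (-s * dt)).le
  linarith

lemma histWeight_nonneg {dt s : ℝ} (hdt : 0 < dt) (i : ℕ) : 0 ≤ histWeight dt s i := by
  induction i with
  | zero =>
    have h1 : -s * dt + 1 ≤ Real.exp (-s * dt) := Real.add_one_le_exp _
    have h2 : 0 ≤ Real.exp (-s * dt) - 1 + s * dt := by linarith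
    simp only [histWeight]
    positivity
  | succ i ih =>
    rw [histWeight_succ]
    have := @exp_moment_nonneg dt s
    split_ifs <;> positivity

/-- Each interior value enters the recurrence twice, as right and as left end of a time step; this
is why `histWeight` has a special entry at `1` and is geometric afterwards. The value `v 0` would
enter only once and break the Toeplitz structure. -/
lemma histMode_eq_sum (dt s : ℝ) (v : ℕ → ℝ) (hv : v 0 = 0) (n : ℕ) :
    histMode dt s v (n + 1) = ∑ i ∈ Finset.range n, histWeight dt s i * v (n - i) := by
  induction n with
  | zero => simp [histMode]
  | succ n ih =>
    rw [histMode, ih, Finset.sum_range_succ']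
    simp only [histWeight_succ, Nat.add_sub_add_right, add_mul, Finset.sum_add_distrib, ite_mul,
      zero_mul, Finset.sum_ite_eq', Finset.mem_range, Nat.sub_zero, Finset.mul_sum, mul_assoc]
    rcases Nat.eq_zero_or_pos n with rfl | hn
    · simp [hv, histWeight]
      ring
    · simp [hn, histWeight]
      ring

/-- The right side is the integral of `exp (-s t)` over `[dt, (n + 1) dt]`, which is the history
mode of the constant `1`. Equality fails only because the nonnegative weight of `v 0` is missing. -/
lemma sum_histWeight_le {dt s : ℝ} (hdt : 0 < dt) (hs : 0 < s) (n : ℕ) :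
    ∑ i ∈ Finset.range n, histWeight dt s i ≤
      (Real.exp (-s * dt) - Real.exp (-s * ((n + 1 : ℕ) * dt))) / s := by
  induction n with
  | zero => simp
  | succ n ih =>
    rw [Finset.sum_range_succ']
    simp only [histWeight_succ, Finset.sum_add_distrib, ← Finset.mul_sum, Finset.sum_ite_eq']
    have hB : 0 ≤ Real.exp (-s * dt) / (s ^ 2 * dt) *
        (1 - Real.exp (-s * dt) - Real.exp (-s * dt) * s * dt) :=
      mul_nonneg (by positivity) exp_moment_nonneg
    have hE : Real.exp (-s * ((n + 1 + 1 : ℕ) * dt)) =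
        Real.exp (-s * dt) * Real.exp (-s * ((n + 1 : ℕ) * dt)) := by
      rw [← Real.exp_add]; congr 1; push_cast; ring
    have hAB : Real.exp (-s * dt) / (s ^ 2 * dt) *
        (1 - Real.exp (-s * dt) - Real.exp (-s * dt) * s * dt) + histWeight dt s 0 =
        (Real.exp (-s * dt) - Real.exp (-s * dt) ^ 2) / s := by
      simp only [histWeight]
      field_simp
      ring
    have h1 := mul_le_mul_of_nonneg_left ih (Real.exp_pos (-s * dt)).le
    calc _ ≤ Real.exp (-s * dt) * ∑ i ∈ Finset.range n, histWeight dt s i +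
          (Real.exp (-s * dt) / (s ^ 2 * dt) *
        (1 - Real.exp (-s * dt) - Real.exp (-s * dt) * s * dt) + histWeight dt s 0) := by
          split_ifs <;> linarith
      _ ≤ _ := by
          rw [hAB, hE]
          refine (add_le_add_left h1 _).trans (le_of_eq ?_)
          field_simp
          ring

/-! ### Integrals of the power kernel and of the sum of exponentials. -/

lemma integral_sumOfExp {m : ℕ} (w s : Fin m → ℝ) (hs : ∀ i, 0 < s i) (a b : ℝ) :
    ∫ t in a..b, ∑ i, w i * Real.exp (-(s i) * t) =
      ∑ i, w i * ((Real.exp (-(s i) * a) - Real.exp (-(s i) * b)) / s i) := by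
  rw [intervalIntegral.integral_finsetSum fun i _ =>
    (by fun_prop : Continuous fun t => w i * Real.exp (-(s i) * t)).intervalIntegrable _ _]
  refine Finset.sum_congr rfl fun i _ => ?_
  have hd : ∀ t ∈ Set.uIcc a b, HasDerivAt (fun t => -(w i / s i) * Real.exp (-(s i) * t))
      (w i * Real.exp (-(s i) * t)) t := by
    intro t _
    have h := (((hasDerivAt_id t).const_mul (-(s i))).exp).const_mul (-(w i / s i))
    refine h.congr_deriv ?_
    have := (hs i).ne'
    simp only [id]
    field_simp
  rw [intervalIntegral.integral_eq_sub_of_hasDerivAt hd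
    ((by fun_prop : Continuous fun t => w i * Real.exp (-(s i) * t)).intervalIntegrable _ _)]
  ring

lemma continuousOn_inv_rpow {β a : ℝ} (ha : 0 < a) (b : ℝ) :
    ContinuousOn (fun t : ℝ => 1 / t ^ (1 + β)) (Set.Icc a b) := by
  have h0 : ∀ t ∈ Set.Icc a b, 0 < t := fun t ht => ha.trans_le ht.1
  refine continuousOn_const.div (continuousOn_id.rpow_const fun t ht => Or.inl (h0 t ht).ne') ?_
  exact fun t ht => (Real.rpow_pos_of_pos (h0 t ht) _).ne'

lemma integral_inv_rpow {β a b : ℝ} (hβ : 0 < β) (ha : 0 < a) (hab : a ≤ b) :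
    ∫ t in a..b, 1 / t ^ (1 + β) = (a ^ (-β) - b ^ (-β)) / β := by
  have hcongr : ∫ t in a..b, 1 / t ^ (1 + β) = ∫ t in a..b, t ^ (-1 - β) := by
    refine intervalIntegral.integral_congr fun t ht => ?_
    rw [Set.uIcc_of_le hab] at ht
    have : 0 < t := ha.trans_le ht.1
    rw [show -1 - β = -(1 + β) by ring, Real.rpow_neg this.le, one_div]
  rw [hcongr, integral_rpow (Or.inr ⟨by linarith, ?_⟩)]
  · rw [show -1 - β + 1 = -β by ring]
    field_simp
    ring
  · rw [Set.uIcc_of_le hab]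
    exact fun h => absurd h.1 (not_le.mpr ha)

lemma IsSumOfExp.nonneg {β ε δ T : ℝ} {m : ℕ} {w s : Fin m → ℝ}
    (h : IsSumOfExp β ε δ T w s) (hδ : δ ≤ T) : 0 ≤ ε :=
  (abs_nonneg _).trans (h.error_le T hδ le_rfl)

lemma IsSumOfExp.sum_le {β ε δ T : ℝ} {m : ℕ} {w s : Fin m → ℝ}
    (h : IsSumOfExp β ε δ T w s) (hβ : 0 < β) (hδ : 0 < δ) {b : ℝ} (hb : δ ≤ b) (hbT : b ≤ T) :
    ∑ i, w i * ((Real.exp (-(s i) * δ) - Real.exp (-(s i) * b)) / s i) ≤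
      (δ ^ (-β) - b ^ (-β)) / β + ε * (b - δ) := by
  rw [← integral_sumOfExp w s h.node_pos, ← integral_inv_rpow hβ hδ hb]
  have hi : IntervalIntegrable (fun t : ℝ => 1 / t ^ (1 + β)) MeasureTheory.volume δ b :=
    ((continuousOn_inv_rpow hδ b).mono (Set.uIcc_of_le hb).subset).intervalIntegrable
  have hε : ∫ t in δ..b, (1 / t ^ (1 + β) + ε) = (∫ t in δ..b, 1 / t ^ (1 + β)) + ε * (b - δ) := by
    rw [intervalIntegral.integral_add hi intervalIntegrable_const]
    simp [mul_comm]
  rw [← hε]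
  refine intervalIntegral.integral_mono_on hb ?_ (hi.add intervalIntegrable_const) fun t ht => ?_
  · exact (by fun_prop : Continuous fun t => ∑ i, w i * Real.exp (-(s i) * t)).intervalIntegrable _ _
  · have := (abs_le.mp (h.error_le t ht.1 (ht.2.trans hbT))).1
    linarith

/-! ### Coercivity of the FIR derivative. -/

lemma sum_shift_eq (z : ℕ → ℝ) (i n : ℕ) :
    ∑ k ∈ Finset.range n, (if i < k then z (k - 1 - i) else 0) =
      ∑ j ∈ Finset.range (n - 1 - i), z j := by
  induction n with
  | zero => simp
  | succ n ih =>
    rw [Finset.sum_range_succ, ih]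
    split_ifs with h
    · rw [show n + 1 - 1 - i = (n - 1 - i) + 1 by omega, Finset.sum_range_succ]
    · rw [show n + 1 - 1 - i = n - 1 - i by omega, add_zero]

/-- A lower triangular Toeplitz matrix with nonpositive off-diagonal entries is coercive as soon as
it is diagonally dominant. -/
lemma toeplitz_coercive {q : ℕ → ℝ} {p S : ℝ} (n : ℕ) (hq : ∀ i, 0 ≤ q i)
    (hS : ∑ i ∈ Finset.range n, q i ≤ S) (y : ℕ → ℝ) :
    (p - S) * ∑ k ∈ Finset.range (n + 1), y k ^ 2 ≤
      ∑ k ∈ Finset.range (n + 1),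
        (p * y k - ∑ i ∈ Finset.range k, q i * y (k - 1 - i)) * y k := by
  -- Row sums and column sums of the off-diagonal part are both partial sums of `q`, hence at most
  -- `S`. The inequality `2 a b ≤ a ^ 2 + b ^ 2` splits every off-diagonal product evenly between
  -- them.
  have hrow : ∑ k ∈ Finset.range (n + 1), (∑ i ∈ Finset.range k, q i) * y k ^ 2 ≤
      S * ∑ k ∈ Finset.range (n + 1), y k ^ 2 := by
    rw [Finset.mul_sum]
    refine Finset.sum_le_sum fun k hk => mul_le_mul_of_nonneg_right ?_ (sq_nonneg _)
    refine le_trans (Finset.sum_le_sum_of_subset_of_nonneg ?_ fun i _ _ => hq i) hS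
    exact Finset.range_mono (by simpa [Nat.lt_succ_iff] using hk)
  have hcol : ∑ k ∈ Finset.range (n + 1), ∑ i ∈ Finset.range k, q i * y (k - 1 - i) ^ 2 ≤
      S * ∑ k ∈ Finset.range (n + 1), y k ^ 2 := by
    have h1 : ∀ k ∈ Finset.range (n + 1), ∑ i ∈ Finset.range k, q i * y (k - 1 - i) ^ 2 =
        ∑ i ∈ Finset.range n, q i * (if i < k then y (k - 1 - i) ^ 2 else 0) := by
      intro k hk
      have hk' : k ≤ n := by simpa [Nat.lt_succ_iff] using hk
      rw [← Finset.sum_subset (Finset.range_mono hk')]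
      · exact Finset.sum_congr rfl fun i hi => by rw [if_pos (Finset.mem_range.mp hi)]
      · intro i _ hi
        rw [if_neg (by simpa using hi), mul_zero]
    rw [Finset.sum_congr rfl h1, Finset.sum_comm]
    refine le_trans ?_ (mul_le_mul_of_nonneg_right hS (Finset.sum_nonneg fun k _ => sq_nonneg (y k)))
    rw [Finset.sum_mul]
    refine Finset.sum_le_sum fun i _ => ?_
    rw [← Finset.mul_sum, sum_shift_eq (fun j => y j ^ 2)]
    refine mul_le_mul_of_nonneg_left ?_ (hq i)
    exact Finset.sum_le_sum_of_subset_of_nonneg (Finset.range_mono (by omega))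
      fun _ _ _ => sq_nonneg _
  have hpt : ∀ k ∈ Finset.range (n + 1),
      p * y k ^ 2 - ((∑ i ∈ Finset.range k, q i) * y k ^ 2 +
        ∑ i ∈ Finset.range k, q i * y (k - 1 - i) ^ 2) / 2 ≤
      (p * y k - ∑ i ∈ Finset.range k, q i * y (k - 1 - i)) * y k := by
    intro k _
    have : (∑ i ∈ Finset.range k, q i * y (k - 1 - i)) * y k ≤
        ((∑ i ∈ Finset.range k, q i) * y k ^ 2 +
        ∑ i ∈ Finset.range k, q i * y (k - 1 - i) ^ 2) / 2 := by
      rw [Finset.sum_mul, Finset.sum_mul, ← Finset.sum_add_distrib, Finset.sum_div]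
      refine Finset.sum_le_sum fun i _ => ?_
      nlinarith [mul_nonneg (hq i) (sq_nonneg (y (k - 1 - i) - y k))]
    linarith
  refine le_trans ?_ (Finset.sum_le_sum hpt)
  rw [Finset.sum_sub_distrib, ← Finset.sum_div, Finset.sum_add_distrib, ← Finset.mul_sum]
  linarith

lemma gamma_two_sub {β : ℝ} (hβ1 : β < 1) :
    Real.Gamma (2 - β) = (1 - β) * Real.Gamma (1 - β) := by
  rw [← Real.Gamma_add_one (by linarith)]
  congr 1
  ring

lemma firDeriv_eq_toeplitz {β dt : ℝ} (hβ1 : β < 1) (hdt : 0 < dt)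
    {m : ℕ} (w s : Fin m → ℝ) (v : ℕ → ℝ) (hv : v 0 = 0) (k : ℕ) :
    firDeriv β dt w s v (k + 1) = 1 / Real.Gamma (1 - β) *
      (1 / ((1 - β) * dt ^ β) * v (k + 1) - ∑ i ∈ Finset.range k,
        ((if i = 0 then 1 / ((1 - β) * dt ^ β) - 1 / dt ^ β else 0) +
          β * ∑ j, w j * histWeight dt (s j) i) * v (k - 1 - i + 1)) := by
  have hG : 0 < Real.Gamma (1 - β) := Real.Gamma_pos_of_pos (by linarith)
  have hd : 0 < dt ^ β := Real.rpow_pos_of_pos hdt _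
  have h1 : 0 < 1 - β := by linarith
  have hsum : ∑ i ∈ Finset.range k,
        ((if i = 0 then 1 / ((1 - β) * dt ^ β) - 1 / dt ^ β else 0) +
          β * ∑ j, w j * histWeight dt (s j) i) * v (k - 1 - i + 1) =
      (1 / ((1 - β) * dt ^ β) - 1 / dt ^ β) * v k +
        β * ∑ j, w j * histMode dt (s j) v (k + 1) := by
    simp only [add_mul, Finset.sum_add_distrib, ite_mul, zero_mul, Finset.sum_ite_eq',
      Finset.mem_range]
    congr 1
    · rcases Nat.eq_zero_or_pos k with rfl | hk
      · simp [hv]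
      · rw [if_pos hk, show k - 1 - 0 + 1 = k by omega]
    · simp only [histMode_eq_sum dt _ v hv, Finset.mul_sum, Finset.sum_mul]
      rw [Finset.sum_comm]
      refine Finset.sum_congr rfl fun j _ => Finset.sum_congr rfl fun i hi => ?_
      rw [show k - 1 - i + 1 = k - i by have := Finset.mem_range.mp hi; omega]
      ring
  rw [hsum, firDeriv, gamma_two_sub hβ1, hv]
  simp only [Nat.add_sub_cancel]
  field_simp
  ring

/-- Coercivity of the FIR derivative on mesh functions that vanish initially. -/
lemma firDeriv_coercive {β ε dt T : ℝ} (hβ : 0 < β) (hβ1 : β < 1) (hdt : 0 < dt)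
    {m : ℕ} {w s : Fin m → ℝ} (hws : IsSumOfExp β ε dt T w s) (v : ℕ → ℝ) (hv : v 0 = 0)
    (n : ℕ) (hn : ((n + 1 : ℕ) : ℝ) * dt ≤ T) :
    ((((n + 1 : ℕ) : ℝ) * dt) ^ (-β) - β * ε * (n * dt)) / Real.Gamma (1 - β) *
        ∑ k ∈ Finset.range (n + 1), v (k + 1) ^ 2 ≤
      ∑ k ∈ Finset.range (n + 1), firDeriv β dt w s v (k + 1) * v (k + 1) := by
  have hG : 0 < Real.Gamma (1 - β) := Real.Gamma_pos_of_pos (by linarith)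
  have hd : 0 < dt ^ β := Real.rpow_pos_of_pos hdt _
  have h1 : 0 < 1 - β := by linarith
  set p : ℝ := 1 / ((1 - β) * dt ^ β) with hp
  set q : ℕ → ℝ := fun i => (if i = 0 then p - 1 / dt ^ β else 0) +
          β * ∑ j, w j * histWeight dt (s j) i with hqdef
  have hpd : 0 ≤ p - 1 / dt ^ β := by
    rw [hp, sub_nonneg]
    apply one_div_le_one_div_of_le (by positivity)
    nlinarith
  have hsumw : ∀ i, 0 ≤ ∑ j, w j * histWeight dt (s j) i := fun i =>
    Finset.sum_nonneg fun j _ => mul_nonneg (hws.weight_pos j).le (histWeight_nonneg hdt i)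
  have hq : ∀ i, 0 ≤ q i := fun i => by
    simp only [hqdef]
    have := hsumw i
    split_ifs <;> positivity
  have htn : dt ≤ ((n + 1 : ℕ) : ℝ) * dt := by
    have : (0 : ℝ) ≤ n * dt := by positivity
    push_cast; linarith
  -- The extra entry `p - 1 / dt ^ β` at `i = 0` turns the `dt ^ (-β)` of the kernel integral into
  -- `p`, so that `p - S` is the claimed constant times `Γ(1 - β)`.
  have hS : ∑ i ∈ Finset.range n, q i ≤
      p - (((n + 1 : ℕ) : ℝ) * dt) ^ (-β) + β * ε * (n * dt) := by
    have h2 : ∑ i ∈ Finset.range n, ∑ j, w j * histWeight dt (s j) i ≤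
        (dt ^ (-β) - (((n + 1 : ℕ) : ℝ) * dt) ^ (-β)) / β + ε * (((n + 1 : ℕ) : ℝ) * dt - dt) := by
      refine le_trans ?_ (hws.sum_le hβ hdt htn hn)
      rw [Finset.sum_comm]
      refine Finset.sum_le_sum fun j _ => ?_
      rw [← Finset.mul_sum]
      exact mul_le_mul_of_nonneg_left (sum_histWeight_le hdt (hws.node_pos j) n)
        (hws.weight_pos j).le
    have h3 := mul_le_mul_of_nonneg_left h2 hβ.le
    have h4 : β * ((dt ^ (-β) - (((n + 1 : ℕ) : ℝ) * dt) ^ (-β)) / β +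
        ε * (((n + 1 : ℕ) : ℝ) * dt - dt)) =
        1 / dt ^ β - (((n + 1 : ℕ) : ℝ) * dt) ^ (-β) + β * ε * (n * dt) := by
      rw [Real.rpow_neg hdt.le β]
      push_cast
      field_simp
      ring
    rw [h4] at h3
    simp only [hqdef, Finset.sum_add_distrib, ← Finset.mul_sum, Finset.sum_ite_eq']
    split_ifs <;> linarith
  have hmain := toeplitz_coercive (p := p) n hq hS fun k => v (k + 1)
  have h5 := mul_le_mul_of_nonneg_left hmain (one_div_pos.mpr hG).le
  calc _ = 1 / Real.Gamma (1 - β) * ((p - (p - (((n + 1 : ℕ) : ℝ) * dt) ^ (-β) +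
        β * ε * (n * dt))) * ∑ k ∈ Finset.range (n + 1), v (k + 1) ^ 2) := by ring
    _ ≤ _ := h5
    _ = _ := by
      rw [Finset.mul_sum]
      refine Finset.sum_congr rfl fun k _ => ?_
      rw [firDeriv_eq_toeplitz hβ1 hdt w s v hv k, mul_assoc]

/-! ### Truncation error in time. -/

/-- Convexity and `Γ(1) = Γ(2) = 1`: the chord over `[1, 2]` has slope `0`, so slopes to its left
are nonpositive and slopes to its right nonnegative. -/
lemma one_le_gamma {y : ℝ} (hy : 0 < y) (hy1 : y ≤ 1) : 1 ≤ Real.Gamma y := by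
  rcases hy1.eq_or_lt with rfl | hlt
  · simp
  · have h := Real.convexOn_Gamma.slope_mono_adjacent (x := y) (y := 1) (z := 2)
      hy (by norm_num [Set.mem_Ioi]) hlt (by norm_num)
    rw [Real.Gamma_one, Real.Gamma_two, sub_self, zero_div,
      div_nonpos_iff] at h
    rcases h with h | h <;> linarith [h.1, h.2]

lemma half_le_gamma {y : ℝ} (hy : 1 < y) (hy2 : y ≤ 2) : 1 / 2 ≤ Real.Gamma y := by
  have h := Real.convexOn_Gamma.slope_mono_adjacent (x := 1) (y := 2) (z := y + 1)
      (by norm_num [Set.mem_Ioi]) (by simp only [Set.mem_Ioi]; linarith) (by norm_num) (by linarith)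
  rw [Real.Gamma_one, Real.Gamma_two, sub_self, zero_div, Real.Gamma_add_one (by linarith),
    div_nonneg_iff] at h
  have hG := Real.Gamma_pos_of_pos (show 0 < y by linarith)
  have h1 : 1 ≤ y * Real.Gamma y := by
    rcases h with h | h <;> linarith [h.1, h.2]
  nlinarith

lemma hasDerivWithinAt_iteratedDerivWithin {f : ℝ → ℝ} {a b : ℝ} (hab : a < b) {n : ℕ}
    (hf : ContDiffOn ℝ n f (Set.Icc a b)) {j : ℕ} (hj : j < n) {x : ℝ} (hx : x ∈ Set.Icc a b) :
    HasDerivWithinAt (iteratedDerivWithin j f (Set.Icc a b))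
      (iteratedDerivWithin (j + 1) f (Set.Icc a b) x) (Set.Icc a b) x := by
  rw [iteratedDerivWithin_succ]
  exact ((hf.differentiableOn_iteratedDerivWithin (by exact_mod_cast hj)
    (uniqueDiffOn_Icc hab)) x hx).hasDerivWithinAt

/-- `g` is differentiable on `[0, T]` with derivative `g'`, which is Lipschitz with constant `M`,
and `g` is bounded by `M`. -/
structure TimeRegular (T M : ℝ) (g g' : ℝ → ℝ) : Prop where
  hasDeriv : ∀ t ∈ Set.Icc 0 T, HasDerivWithinAt g (g' t) (Set.Icc 0 T) t
  lipschitz : ∀ a ∈ Set.Icc 0 T, ∀ b ∈ Set.Icc 0 T, |g' a - g' b| ≤ M * |a - b|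
  bound : ∀ t ∈ Set.Icc 0 T, |g t| ≤ M

namespace TimeRegular

variable {T M : ℝ} {g g' : ℝ → ℝ}

lemma continuousOn (h : TimeRegular T M g g') : ContinuousOn g (Set.Icc 0 T) :=
  fun t ht => (h.hasDeriv t ht).continuousWithinAt

lemma continuousOn_deriv (h : TimeRegular T M g g') : ContinuousOn g' (Set.Icc 0 T) := by
  have : LipschitzOnWith M.toNNReal g' (Set.Icc 0 T) := by
    refine LipschitzOnWith.of_dist_le_mul fun a ha b hb => ?_
    rw [Real.dist_eq, Real.dist_eq]
    exact (h.lipschitz a ha b hb).trans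
      (mul_le_mul_of_nonneg_right (Real.le_coe_toNNReal M) (abs_nonneg _))
  exact this.continuousOn

lemma hasDerivAt (h : TimeRegular T M g g') {t : ℝ} (ht : t ∈ Set.Ioo 0 T) :
    HasDerivAt g (g' t) t :=
  (h.hasDeriv t ⟨ht.1.le, ht.2.le⟩).hasDerivAt (Icc_mem_nhds ht.1 ht.2)

lemma nonneg (h : TimeRegular T M g g') (hT : 0 ≤ T) : 0 ≤ M :=
  (abs_nonneg _).trans (h.bound 0 ⟨le_rfl, hT⟩)

lemma slope_error (h : TimeRegular T M g g') {a b : ℝ} (ha : 0 ≤ a) (hab : a < b) (hb : b ≤ T)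
    {x : ℝ} (hx : x ∈ Set.Icc a b) : |g' x - (g b - g a) / (b - a)| ≤ M * (b - a) := by
  have hsub : Set.Icc a b ⊆ Set.Icc 0 T := Set.Icc_subset_Icc ha hb
  obtain ⟨c, hc, hc'⟩ := exists_hasDerivAt_eq_slope g g' hab (h.continuousOn.mono hsub)
    fun x hx => h.hasDerivAt ⟨ha.trans_lt hx.1, hx.2.trans_le hb⟩
  rw [← hc']
  refine (h.lipschitz x (hsub hx) c (hsub ⟨hc.1.le, hc.2.le⟩)).trans ?_
  refine mul_le_mul_of_nonneg_left ?_ (h.nonneg (ha.trans (hab.le.trans hb)))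
  rw [abs_le]
  constructor <;> linarith [hx.1, hx.2, hc.1, hc.2]

lemma interpolation_error (h : TimeRegular T M g g') {a b : ℝ} (ha : 0 ≤ a) (hab : a < b)
    (hb : b ≤ T) {x : ℝ} (hx : x ∈ Set.Icc a b) :
    |g a + (g b - g a) / (b - a) * (x - a) - g x| ≤ M * (b - a) ^ 2 := by
  have hsub : Set.Icc a b ⊆ Set.Icc 0 T := Set.Icc_subset_Icc ha hb
  have hM := h.nonneg (ha.trans (hab.le.trans hb))
  have hd : ∀ y ∈ Set.Icc a b, HasDerivWithinAt (fun y => g y - (g b - g a) / (b - a) * y)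
      (g' y - (g b - g a) / (b - a)) (Set.Icc a b) y := fun y hy => by
    refine (((h.hasDeriv y (hsub hy)).mono hsub).fun_sub
      ((hasDerivWithinAt_id y _).const_mul ((g b - g a) / (b - a)))).congr_deriv ?_
    rw [mul_one]
  have h1 := (convex_Icc a b).norm_image_sub_le_of_norm_hasDerivWithin_le hd
    (fun y hy => h.slope_error ha hab hb hy) (Set.left_mem_Icc.mpr hab.le) hx
  rw [Real.norm_eq_abs, Real.norm_eq_abs, abs_sub_comm] at h1
  calc _ = |g a - (g b - g a) / (b - a) * a - (g x - (g b - g a) / (b - a) * x)| := by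
        congr 1; ring
    _ ≤ _ := h1
    _ ≤ M * (b - a) * (b - a) := by
        refine mul_le_mul_of_nonneg_left ?_ (mul_nonneg hM (by linarith))
        rw [abs_le]
        constructor <;> linarith [hx.1, hx.2]
    _ = _ := by ring

lemma interpolation_bound (h : TimeRegular T M g g') {a b : ℝ} (ha : 0 ≤ a) (hab : a < b)
    (hb : b ≤ T) {x : ℝ} (hx : x ∈ Set.Icc a b) :
    |g a + (g b - g a) / (b - a) * (x - a)| ≤ M := by
  have h1 := abs_le.mp (h.bound a ⟨ha, hab.le.trans hb⟩)
  have h2 := abs_le.mp (h.bound b ⟨ha.trans hab.le, hb⟩)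
  set r := (x - a) / (b - a) with hr
  have hr0 : 0 ≤ r := div_nonneg (by linarith [hx.1]) (by linarith)
  have hr1 : r ≤ 1 := (div_le_one (by linarith)).mpr (by linarith [hx.2])
  have : g a + (g b - g a) / (b - a) * (x - a) = (1 - r) * g a + r * g b := by
    rw [hr]; ring
  rw [this, abs_le]
  constructor <;> nlinarith

end TimeRegular

lemma intervalIntegrable_inv_rpow_sub {β : ℝ} (hβ1 : β < 1) {a b : ℝ} (hab : a ≤ b) :
    IntervalIntegrable (fun s : ℝ => 1 / (b - s) ^ β) volume a b := by
  have h := (intervalIntegral.intervalIntegrable_rpow' (a := 0) (b := b - a)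
    (show -1 < -β by linarith)).comp_sub_left b
  simp only [sub_zero, sub_sub_cancel] at h
  refine h.symm.congr_ae ?_
  refine (ae_restrict_mem measurableSet_uIoc).mono fun s hs => ?_
  rw [Set.uIoc_of_le hab] at hs
  simp only
  rw [Real.rpow_neg (by linarith [hs.2]), one_div]

lemma integral_inv_rpow_sub {β : ℝ} (hβ1 : β < 1) {a b : ℝ} (hab : a ≤ b) :
    ∫ s in a..b, 1 / (b - s) ^ β = (b - a) ^ (1 - β) / (1 - β) := by
  rw [intervalIntegral.integral_comp_sub_left (fun y : ℝ => 1 / y ^ β) b, sub_self]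
  have hcongr : ∫ y in (0 : ℝ)..(b - a), 1 / y ^ β = ∫ y in (0 : ℝ)..(b - a), y ^ (-β) := by
    refine intervalIntegral.integral_congr fun y hy => ?_
    rw [Set.uIcc_of_le (by linarith)] at hy
    rw [Real.rpow_neg hy.1, one_div]
  rw [hcongr, integral_rpow (Or.inl (by linarith)), show -β + 1 = 1 - β by ring,
    Real.zero_rpow (by linarith), sub_zero]

lemma intervalIntegrable_div_rpow_sub {β : ℝ} (hβ1 : β < 1) {a b : ℝ} (hab : a ≤ b) {φ : ℝ → ℝ}
    (hφ : ContinuousOn φ (Set.Icc a b)) :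
    IntervalIntegrable (fun s : ℝ => φ s / (b - s) ^ β) volume a b := by
  have h := (intervalIntegrable_inv_rpow_sub hβ1 hab).continuousOn_mul
    (hφ.mono (Set.uIcc_of_le hab).subset)
  simpa only [mul_one_div] using h

namespace TimeRegular

variable {T M : ℝ} {g g' : ℝ → ℝ}

/-- `caputo` uses the two-sided `deriv`, which agrees with the one-sided derivative inside the
interval; the end points do not affect the integral. -/
lemma caputo_eq (h : TimeRegular T M g g') {β t : ℝ} (ht : 0 ≤ t) (htT : t ≤ T) :
    caputo β g t = 1 / Real.Gamma (1 - β) * ∫ s in (0 : ℝ)..t, g' s / (t - s) ^ β := by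
  rw [caputo]
  congr 1
  refine intervalIntegral.integral_congr_Ioo_of_le ht fun s hs => ?_
  rw [(h.hasDerivAt ⟨hs.1, hs.2.trans_le htT⟩).deriv]

/-- The contribution of the last time step. -/
lemma local_error (h : TimeRegular T M g g') {β : ℝ} (hβ1 : β < 1) {a b : ℝ} (ha : 0 ≤ a)
    (hab : a < b) (hb : b ≤ T) :
    |(g b - g a) / (b - a) * ((b - a) ^ (1 - β) / (1 - β)) - ∫ s in a..b, g' s / (b - s) ^ β| ≤
      M * (b - a) * ((b - a) ^ (1 - β) / (1 - β)) := by
  have hsub : Set.Icc a b ⊆ Set.Icc 0 T := Set.Icc_subset_Icc ha hb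
  have hi := intervalIntegrable_inv_rpow_sub hβ1 hab.le
  have hi' := intervalIntegrable_div_rpow_sub hβ1 hab.le (h.continuousOn_deriv.mono hsub)
  rw [← integral_inv_rpow_sub hβ1 hab.le, ← intervalIntegral.integral_const_mul,
    ← intervalIntegral.integral_const_mul,
    ← intervalIntegral.integral_sub (hi.const_mul _) hi']
  rw [← Real.norm_eq_abs]
  refine intervalIntegral.norm_integral_le_of_norm_le hab.le (Filter.Eventually.of_forall ?_)
    (hi.const_mul _)
  intro s hs
  have hpos : 0 ≤ 1 / (b - s) ^ β :=
    one_div_nonneg.mpr (Real.rpow_nonneg (by linarith [hs.2]) _)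
  have := h.slope_error ha hab hb ⟨hs.1.le, hs.2⟩
  rw [Real.norm_eq_abs, show (g b - g a) / (b - a) * (1 / (b - s) ^ β) - g' s / (b - s) ^ β =
    ((g b - g a) / (b - a) - g' s) * (1 / (b - s) ^ β) by ring, abs_mul, abs_of_nonneg hpos,
    abs_sub_comm]
  exact mul_le_mul_of_nonneg_right this hpos

/-- Moves the derivative off `g` away from the singularity; the FIR formula discretizes the
resulting right side with `c = t_{n-1}`. -/
lemma integral_by_parts (h : TimeRegular T M g g') {β : ℝ} {c t : ℝ} (hc : 0 ≤ c) (hct : c < t)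
    (htT : t ≤ T) :
    ∫ s in (0 : ℝ)..c, g' s / (t - s) ^ β = g c / (t - c) ^ β - g 0 / t ^ β -
      β * ∫ s in (0 : ℝ)..c, g s * (1 / (t - s) ^ (1 + β)) := by
  have hsub : Set.Icc 0 c ⊆ Set.Icc 0 T := Set.Icc_subset_Icc le_rfl (hct.le.trans htT)
  have hpos : ∀ s ∈ Set.Icc 0 c, 0 < t - s := fun s hs => by linarith [hs.2]
  have hcr : ∀ γ : ℝ, ContinuousOn (fun s : ℝ => (t - s) ^ γ) (Set.Icc 0 c) := fun γ =>
    (continuousOn_const.sub continuousOn_id).rpow_const fun s hs => Or.inl (hpos s hs).ne'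
  have hne : ∀ γ : ℝ, ∀ s ∈ Set.Icc 0 c, (t - s) ^ γ ≠ 0 := fun γ s hs =>
    (Real.rpow_pos_of_pos (hpos s hs) _).ne'
  have hcg := h.continuousOn.mono hsub
  have hcg' := h.continuousOn_deriv.mono hsub
  have hi1 : IntervalIntegrable (fun s => g' s / (t - s) ^ β) volume 0 c :=
    ((hcg'.div (hcr β) (hne β)).mono (Set.uIcc_of_le hc).subset).intervalIntegrable
  have hi2 : IntervalIntegrable (fun s => g s * (1 / (t - s) ^ (1 + β))) volume 0 c :=
    ((hcg.mul (continuousOn_const.div (hcr (1 + β)) (hne _))).mono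
      (Set.uIcc_of_le hc).subset).intervalIntegrable
  have hF := intervalIntegral.integral_eq_sub_of_hasDerivAt_of_le (f := fun s => g s / (t - s) ^ β)
    (f' := fun s => g' s / (t - s) ^ β + β * (g s * (1 / (t - s) ^ (1 + β)))) hc
    (hcg.div (hcr β) (hne β)) ?_ (hi1.add (hi2.const_mul β))
  · rw [intervalIntegral.integral_add hi1 (hi2.const_mul β),
      intervalIntegral.integral_const_mul] at hF
    rw [sub_zero] at hF
    linarith
  · intro s hs
    have hp := hpos s ⟨hs.1.le, hs.2.le⟩
    have hd := (h.hasDerivAt ⟨hs.1, hs.2.trans (hct.trans_le htT)⟩).div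
      (((hasDerivAt_id s).const_sub t).rpow_const (p := β) (Or.inl hp.ne'))
      (Real.rpow_pos_of_pos hp _).ne'
    refine hd.congr_deriv ?_
    have e1 : (t - s) ^ β = (t - s) ^ (β - 1) * (t - s) := by
      rw [← Real.rpow_add_one hp.ne', sub_add_cancel]
    have e2 : (t - s) ^ (1 + β) = (t - s) ^ (β - 1) * (t - s) * (t - s) := by
      rw [← e1, ← Real.rpow_add_one hp.ne', add_comm]
    have hq := Real.rpow_pos_of_pos hp (β - 1)
    simp only [id]
    rw [e2, e1]
    field_simp
    ring

end TimeRegular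

/-- The linear interpolant of the mesh function `v` on the time step starting at `l * dt`. -/
def linInterp (dt : ℝ) (v : ℕ → ℝ) (l : ℕ) (τ : ℝ) : ℝ :=
  v l + (v (l + 1) - v l) / dt * (τ - l * dt)

lemma continuous_linInterp (dt : ℝ) (v : ℕ → ℝ) (l : ℕ) : Continuous (linInterp dt v l) := by
  unfold linInterp
  fun_prop

lemma integral_exp_linInterp {dt s : ℝ} (hdt : 0 < dt) (hs : 0 < s) (v : ℕ → ℝ) (l : ℕ) :
    ∫ τ in ((l : ℕ) * dt)..((l + 1 : ℕ) * dt),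
        Real.exp (-s * ((l + 2 : ℕ) * dt - τ)) * linInterp dt v l τ =
      Real.exp (-s * dt) / (s ^ 2 * dt) *
        ((Real.exp (-s * dt) - 1 + s * dt) * v (l + 1) +
          (1 - Real.exp (-s * dt) - Real.exp (-s * dt) * s * dt) * v l) := by
  have hd : ∀ τ ∈ Set.uIcc ((l : ℝ) * dt) ((l + 1 : ℕ) * dt), HasDerivAt
      (fun τ => Real.exp (-s * ((l + 2 : ℕ) * dt - τ)) *
        (linInterp dt v l τ / s - (v (l + 1) - v l) / dt / s ^ 2))
      (Real.exp (-s * ((l + 2 : ℕ) * dt - τ)) * linInterp dt v l τ) τ := by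
    intro τ _
    have h1 := ((((hasDerivAt_id τ).const_sub ((l + 2 : ℕ) * dt)).const_mul (-s)).exp)
    have h2 := ((((((hasDerivAt_id τ).sub_const (l * dt)).const_mul
      ((v (l + 1) - v l) / dt)).const_add (v l)).div_const s).sub_const
      ((v (l + 1) - v l) / dt / s ^ 2))
    refine (h1.mul h2).congr_deriv ?_
    simp only [linInterp, id]
    field_simp
    ring
  rw [intervalIntegral.integral_eq_sub_of_hasDerivAt hd
    ((by have := continuous_linInterp dt v l; fun_prop : Continuous fun τ =>
      Real.exp (-s * ((l + 2 : ℕ) * dt - τ)) * linInterp dt v l τ).intervalIntegrable _ _)]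
  have e1 : Real.exp (-s * ((l + 2 : ℕ) * dt - (l + 1 : ℕ) * dt)) = Real.exp (-s * dt) := by
    congr 1; push_cast; ring
  have e2 : Real.exp (-s * ((l + 2 : ℕ) * dt - l * dt)) =
      Real.exp (-s * dt) * Real.exp (-s * dt) := by
    rw [← Real.exp_add]; congr 1; push_cast; ring
  rw [e1, e2]
  simp only [linInterp]
  push_cast
  field_simp
  ring

/-- The recurrence involves no quadrature error: advancing `t` by `dt` multiplies the old integral
by `exp (-s dt)`, and the newest cell is integrated in closed form. -/
lemma histMode_eq_integral {dt s : ℝ} (hdt : 0 < dt) (hs : 0 < s) (v : ℕ → ℝ) (n : ℕ) :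
    histMode dt s v (n + 1) = ∑ l ∈ Finset.range n, ∫ τ in ((l : ℕ) * dt)..((l + 1 : ℕ) * dt),
        Real.exp (-s * ((n + 1 : ℕ) * dt - τ)) * linInterp dt v l τ := by
  induction n with
  | zero => simp [histMode]
  | succ n ih =>
    rw [histMode, ih, Finset.sum_range_succ, integral_exp_linInterp hdt hs, Finset.mul_sum]
    congr 1
    refine Finset.sum_congr rfl fun l _ => ?_
    rw [← intervalIntegral.integral_const_mul]
    refine intervalIntegral.integral_congr fun τ _ => ?_
    rw [← mul_assoc, ← Real.exp_add]
    congr 2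
    push_cast
    ring

lemma sum_histMode_eq_integral {dt : ℝ} (hdt : 0 < dt) {m : ℕ} (w s : Fin m → ℝ)
    (hs : ∀ i, 0 < s i) (v : ℕ → ℝ) (n : ℕ) :
    ∑ i, w i * histMode dt (s i) v (n + 1) =
      ∑ l ∈ Finset.range n, ∫ τ in ((l : ℕ) * dt)..((l + 1 : ℕ) * dt),
        linInterp dt v l τ * ∑ i, w i * Real.exp (-(s i) * ((n + 1 : ℕ) * dt - τ)) := by
  simp only [histMode_eq_integral hdt (hs _), Finset.mul_sum]
  rw [Finset.sum_comm]
  refine Finset.sum_congr rfl fun l _ => ?_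
  rw [intervalIntegral.integral_finsetSum]
  · refine Finset.sum_congr rfl fun i _ => ?_
    rw [← intervalIntegral.integral_const_mul]
    refine intervalIntegral.integral_congr fun τ _ => ?_
    ring
  · intro i _
    have := continuous_linInterp dt v l
    exact (by fun_prop : Continuous _).intervalIntegrable _ _

/-- The error of the history part. -/
lemma TimeRegular.history_error {T M : ℝ} {g g' : ℝ → ℝ} (h : TimeRegular T M g g')
    {β ε dt : ℝ} (hβ : 0 < β) (hdt : 0 < dt) {m : ℕ} {w s : Fin m → ℝ}
    (hws : IsSumOfExp β ε dt T w s) (n : ℕ) (hn : ((n + 1 : ℕ) : ℝ) * dt ≤ T) :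
    |∑ i, w i * histMode dt (s i) (fun k => g (k * dt)) (n + 1) -
        ∫ τ in (0 : ℝ)..(n * dt), g τ * (1 / ((n + 1 : ℕ) * dt - τ) ^ (1 + β))| ≤
      M * ε * (n * dt) + M * dt ^ 2 * (dt ^ (-β) / β) := by
  set t : ℝ := (n + 1 : ℕ) * dt with ht
  have htn : t - n * dt = dt := by rw [ht]; push_cast; ring
  have hnd : (0 : ℝ) ≤ n * dt := by positivity
  have hM := h.nonneg (by linarith : (0 : ℝ) ≤ T)
  have hκ : ∀ τ ∈ Set.Icc 0 (n * dt), 0 < t - τ := fun τ hτ => by linarith [hτ.2]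
  have hcκ : ContinuousOn (fun τ : ℝ => 1 / (t - τ) ^ (1 + β)) (Set.Icc 0 (n * dt)) := by
    refine continuousOn_const.div ((continuousOn_const.sub continuousOn_id).rpow_const
      fun τ hτ => Or.inl (hκ τ hτ).ne') fun τ hτ => (Real.rpow_pos_of_pos (hκ τ hτ) _).ne'
  have hsub : Set.Icc 0 (n * dt) ⊆ Set.Icc 0 T := Set.Icc_subset_Icc le_rfl (by linarith)
  have hcell : ∀ l < n, Set.Icc ((l : ℝ) * dt) ((l + 1 : ℕ) * dt) ⊆ Set.Icc 0 (n * dt) := by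
    intro l hl
    refine Set.Icc_subset_Icc (by positivity) (mul_le_mul_of_nonneg_right ?_ hdt.le)
    exact_mod_cast hl
  have hle : ∀ l : ℕ, (l : ℝ) * dt ≤ (l + 1 : ℕ) * dt := fun l => by push_cast; linarith
  have hiκ : ∀ l < n, IntervalIntegrable (fun τ : ℝ => 1 / (t - τ) ^ (1 + β)) volume
      ((l : ℝ) * dt) ((l + 1 : ℕ) * dt) := fun l hl =>
    (hcκ.mono ((Set.uIcc_of_le (hle l)).subset.trans (hcell l hl))).intervalIntegrable
  have hig : ∀ l < n, IntervalIntegrable (fun τ : ℝ => g τ * (1 / (t - τ) ^ (1 + β))) volume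
      ((l : ℝ) * dt) ((l + 1 : ℕ) * dt) := fun l hl =>
    (((h.continuousOn.mono hsub).mul hcκ).mono
      ((Set.uIcc_of_le (hle l)).subset.trans (hcell l hl))).intervalIntegrable
  have hib : ∀ l < n, IntervalIntegrable (fun τ : ℝ => M * ε + M * dt ^ 2 *
      (1 / (t - τ) ^ (1 + β))) volume ((l : ℝ) * dt) ((l + 1 : ℕ) * dt) := fun l hl =>
    intervalIntegrable_const.add ((hiκ l hl).const_mul _)
  have hsumg := intervalIntegral.sum_integral_adjacent_intervals (a := fun l : ℕ => (l : ℝ) * dt) hig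
  have hsumb := intervalIntegral.sum_integral_adjacent_intervals (a := fun l : ℕ => (l : ℝ) * dt) hib
  simp only [Nat.cast_zero, zero_mul] at hsumg hsumb
  have hbound : ∫ τ in (0 : ℝ)..(n * dt), (M * ε + M * dt ^ 2 * (1 / (t - τ) ^ (1 + β))) ≤
      M * ε * (n * dt) + M * dt ^ 2 * (dt ^ (-β) / β) := by
    have hi0 : IntervalIntegrable (fun τ : ℝ => 1 / (t - τ) ^ (1 + β)) volume 0 (n * dt) :=
      (hcκ.mono (Set.uIcc_of_le hnd).subset).intervalIntegrable
    rw [intervalIntegral.integral_add intervalIntegrable_const (hi0.const_mul _),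
      intervalIntegral.integral_const, intervalIntegral.integral_const_mul,
      intervalIntegral.integral_comp_sub_left (fun y : ℝ => 1 / y ^ (1 + β)) t, htn, sub_zero,
      integral_inv_rpow hβ hdt (by linarith), smul_eq_mul, sub_zero, mul_comm (n * dt)]
    have : 0 ≤ t ^ (-β) := Real.rpow_nonneg (by linarith) _
    gcongr
    linarith
  refine le_trans ?_ hbound
  rw [sum_histMode_eq_integral hdt w s hws.node_pos, ← hsumg, ← hsumb, ← Finset.sum_sub_distrib]
  refine (Finset.abs_sum_le_sum_abs _ _).trans (Finset.sum_le_sum fun l hl => ?_)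
  have hl := Finset.mem_range.mp hl
  have hcl := continuous_linInterp dt (fun k => g (k * dt)) l
  rw [← intervalIntegral.integral_sub ((by fun_prop : Continuous _).intervalIntegrable _ _)
    (hig l hl)]
  rw [← Real.norm_eq_abs]
  refine intervalIntegral.norm_integral_le_of_norm_le (hle l) (Filter.Eventually.of_forall ?_)
    (hib l hl)
  intro τ hτ
  have hτ' : τ ∈ Set.Icc ((l : ℝ) * dt) ((l + 1 : ℕ) * dt) := ⟨hτ.1.le, hτ.2⟩
  have hτn := hcell l hl hτ'
  have hdiff : ((l + 1 : ℕ) : ℝ) * dt - l * dt = dt := by push_cast; ring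
  have hlT : ((l + 1 : ℕ) : ℝ) * dt ≤ T :=
    (hcell l hl (Set.right_mem_Icc.mpr (hle l))).2.trans (by linarith)
  have hl0 : (0 : ℝ) ≤ l * dt := by positivity
  have hlt : (l : ℝ) * dt < (l + 1 : ℕ) * dt := by linarith
  have hint := h.interpolation_error hl0 hlt hlT hτ'
  have hbd := h.interpolation_bound hl0 hlt hlT hτ'
  rw [hdiff] at hint hbd
  have hK := hws.error_le (t - τ) (by linarith [hτn.2]) (by linarith [hτn.1])
  have hκp : 0 ≤ 1 / (t - τ) ^ (1 + β) :=
    one_div_nonneg.mpr (Real.rpow_nonneg (hκ τ hτn).le _)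
  set κ := 1 / (t - τ) ^ (1 + β)
  set K := ∑ i, w i * Real.exp (-(s i) * (t - τ))
  have hlin : linInterp dt (fun k => g (k * dt)) l τ =
      g (l * dt) + (g ((l + 1 : ℕ) * dt) - g (l * dt)) / dt * (τ - l * dt) := rfl
  rw [← hlin] at hint hbd
  set ℓ := linInterp dt (fun k => g (k * dt)) l τ
  -- The interpolant is bounded by `M` and meets the kernel error `ε`, available because `t - τ ≥
  -- dt`; the interpolation error `M dt ^ 2` meets the exact kernel.
  rw [Real.norm_eq_abs, show ℓ * K - g τ * κ = -(ℓ * (κ - K)) + (ℓ - g τ) * κ by ring]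
  refine (abs_add_le _ _).trans (add_le_add ?_ ?_)
  · rw [abs_neg, abs_mul]
    exact mul_le_mul hbd hK (abs_nonneg _) hM
  · rw [abs_mul, abs_of_nonneg hκp]
    exact mul_le_mul_of_nonneg_right hint hκp

/-- The truncation error of the FIR approximation of the Caputo derivative. -/
lemma TimeRegular.firDeriv_error {T M : ℝ} {g g' : ℝ → ℝ} (h : TimeRegular T M g g')
    {β ε dt : ℝ} (hβ : 0 < β) (hβ1 : β < 1) (hdt : 0 < dt) {m : ℕ} {w s : Fin m → ℝ}
    (hws : IsSumOfExp β ε dt T w s) (n : ℕ) (hn : ((n + 1 : ℕ) : ℝ) * dt ≤ T) :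
    |firDeriv β dt w s (fun k => g (k * dt)) (n + 1) - caputo β g ((n + 1 : ℕ) * dt)| ≤
      M * (3 * dt ^ (2 - β) + T * (β * ε)) := by
  set t : ℝ := (n + 1 : ℕ) * dt with ht
  have htn : t - n * dt = dt := by rw [ht]; push_cast; ring
  have hnd : (0 : ℝ) ≤ n * dt := by positivity
  have hM := h.nonneg (by linarith : (0 : ℝ) ≤ T)
  have hε := hws.nonneg (by linarith)
  have hG : 1 ≤ Real.Gamma (1 - β) := one_le_gamma (by linarith) (by linarith)
  have hG2 : 1 / 2 ≤ Real.Gamma (2 - β) := half_le_gamma (by linarith) (by linarith)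
  have hΓ := gamma_two_sub hβ1
  have h1 : 0 < 1 - β := by linarith
  have hhist := h.history_error hβ hdt hws n hn
  have hloc := h.local_error hβ1 hnd (show n * dt < t by linarith) hn
  have hparts := h.integral_by_parts (β := β) hnd (show n * dt < t by linarith) hn
  have hc1 : ContinuousOn g' (Set.Icc 0 t) :=
    h.continuousOn_deriv.mono (Set.Icc_subset_Icc le_rfl hn)
  have hi := intervalIntegrable_div_rpow_sub hβ1 (show 0 ≤ t by linarith) hc1
  have hmem : n * dt ∈ Set.uIcc 0 t := by
    rw [Set.uIcc_of_le (by linarith)]; constructor <;> linarith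
  have hadd := intervalIntegral.integral_add_adjacent_intervals
    (hi.mono_set (Set.uIcc_subset_uIcc Set.left_mem_uIcc hmem))
    (hi.mono_set (Set.uIcc_subset_uIcc hmem Set.right_mem_uIcc))
  rw [h.caputo_eq (by linarith) hn, ← hadd, hparts]
  rw [htn] at hloc ⊢
  set I := ∫ s in (n * dt)..t, g' s / (t - s) ^ β
  set E := ∑ i, w i * histMode dt (s i) (fun k => g (k * dt)) (n + 1)
  set J := ∫ τ in (0 : ℝ)..(n * dt), g τ * (1 / (t - τ) ^ (1 + β))
  have hd : 0 < dt ^ β := Real.rpow_pos_of_pos hdt _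
  have hp1 : dt ^ (1 - β) = dt / dt ^ β := by rw [Real.rpow_sub hdt, Real.rpow_one]
  have hp2 : dt ^ (2 - β) = dt ^ 2 / dt ^ β := by
    rw [Real.rpow_sub hdt]; norm_num
  have hp3 : dt ^ (-β) = 1 / dt ^ β := by rw [Real.rpow_neg hdt.le, one_div]
  have hG0 : 0 < Real.Gamma (1 - β) := by linarith
  have hfir : firDeriv β dt w s (fun k => g (k * dt)) (n + 1) -
      1 / Real.Gamma (1 - β) * (g (n * dt) / dt ^ β - g 0 / t ^ β - β * J + I) =
      1 / Real.Gamma (1 - β) * (((g t - g (n * dt)) / dt * (dt ^ (1 - β) / (1 - β)) - I) -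
        β * (E - J)) := by
    have hdef : firDeriv β dt w s (fun k => g (k * dt)) (n + 1) =
        (g t - g (n * dt)) / (dt ^ β * Real.Gamma (2 - β)) +
          1 / Real.Gamma (1 - β) * (g (n * dt) / dt ^ β - g 0 / t ^ β - β * E) := by
      simp only [firDeriv, Nat.add_sub_cancel, Nat.cast_zero, zero_mul, E, ht]
    rw [hdef, hΓ, hp1]
    field_simp
    ring
  rw [hfir, mul_sub, ← mul_assoc]
  refine (abs_sub _ _).trans ?_
  rw [abs_mul, abs_mul, abs_of_pos (one_div_pos.mpr hG0),
    abs_of_pos (mul_pos (one_div_pos.mpr hG0) hβ)]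
  have b1 : 1 / Real.Gamma (1 - β) *
      |(g t - g (n * dt)) / dt * (dt ^ (1 - β) / (1 - β)) - I| ≤ 2 * (M * dt ^ (2 - β)) := by
    calc _ ≤ 1 / Real.Gamma (1 - β) * (M * dt * (dt ^ (1 - β) / (1 - β))) :=
          mul_le_mul_of_nonneg_left hloc (one_div_pos.mpr hG0).le
      _ = 1 / Real.Gamma (2 - β) * (M * dt ^ (2 - β)) := by
          rw [hΓ, hp1, hp2]; field_simp
      _ ≤ 2 * (M * dt ^ (2 - β)) := by
          refine mul_le_mul_of_nonneg_right ?_ (mul_nonneg hM (Real.rpow_nonneg hdt.le _))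
          rw [div_le_iff₀ (by linarith)]
          linarith
  -- The prefactor `β` cancels the `1 / β` of the history error and supplies the factor `β` of `ε`.
  have b2 : 1 / Real.Gamma (1 - β) * β * |E - J| ≤ M * T * (β * ε) + M * dt ^ (2 - β) := by
    calc _ ≤ 1 * β * (M * ε * (n * dt) + M * dt ^ 2 * (dt ^ (-β) / β)) := by
          have : 1 / Real.Gamma (1 - β) ≤ 1 := by
            rw [div_le_one hG0]; exact hG
          gcongr
      _ = M * (n * dt) * (β * ε) + M * dt ^ (2 - β) := by
          rw [hp2, hp3]; field_simp
      _ ≤ _ := by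
          have : n * dt ≤ T := by linarith
          gcongr
  linarith

/-! ### Taylor expansion and truncation error in space. -/

/-- Mean value inequality on the segment from `x` to `y`. The same `C` comes out, so it can be
iterated down from the highest derivative, at the price of losing the factorials. -/
lemma abs_le_pow_succ_of_deriv {F F' : ℝ → ℝ} {a b C x : ℝ} {k : ℕ} (hC : 0 ≤ C)
    (hF : ∀ z ∈ Set.Icc a b, HasDerivWithinAt F (F' z) (Set.Icc a b) z)
    (hF' : ∀ z ∈ Set.Icc a b, |F' z| ≤ C * |z - x| ^ k) (hx : x ∈ Set.Icc a b) (h0 : F x = 0)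
    {y : ℝ} (hy : y ∈ Set.Icc a b) : |F y| ≤ C * |y - x| ^ (k + 1) := by
  have hsub : Set.uIcc x y ⊆ Set.Icc a b := Set.uIcc_subset_Icc hx hy
  have h := (convex_uIcc x y).norm_image_sub_le_of_norm_hasDerivWithin_le
    (C := C * |y - x| ^ k) (fun z hz => (hF z (hsub hz)).mono hsub) (fun z hz => ?_)
    Set.left_mem_uIcc Set.right_mem_uIcc
  · rw [h0, sub_zero, Real.norm_eq_abs, Real.norm_eq_abs, mul_assoc, ← pow_succ] at h
    exact h
  · refine (hF' z (hsub hz)).trans ?_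
    have := Set.abs_sub_left_of_mem_uIcc hz
    gcongr

lemma taylor_two_error {q₀ q₁ q₂ q₃ : ℝ → ℝ} {a b M : ℝ}
    (h₀ : ∀ z ∈ Set.Icc a b, HasDerivWithinAt q₀ (q₁ z) (Set.Icc a b) z)
    (h₁ : ∀ z ∈ Set.Icc a b, HasDerivWithinAt q₁ (q₂ z) (Set.Icc a b) z)
    (h₂ : ∀ z ∈ Set.Icc a b, HasDerivWithinAt q₂ (q₃ z) (Set.Icc a b) z)
    (hM : ∀ z ∈ Set.Icc a b, |q₃ z| ≤ M) {x y : ℝ} (hx : x ∈ Set.Icc a b) (hy : y ∈ Set.Icc a b) :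
    |q₀ y - (q₀ x + q₁ x * (y - x) + q₂ x * (y - x) ^ 2 / 2)| ≤ M * |y - x| ^ 3 := by
  have hM0 : 0 ≤ M := (abs_nonneg _).trans (hM x hx)
  have hid : ∀ z, HasDerivWithinAt (fun z => z - x) 1 (Set.Icc a b) z := fun z =>
    (hasDerivWithinAt_id z _).sub_const x
  have b2 : ∀ z ∈ Set.Icc a b, |q₂ z - q₂ x| ≤ M * |z - x| ^ 1 := fun z hz =>
    abs_le_pow_succ_of_deriv (F := fun z => q₂ z - q₂ x) (k := 0) hM0
      (fun z hz => (h₂ z hz).sub_const _) (by simpa using hM) hx (sub_self _) hz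
  have b1 : ∀ z ∈ Set.Icc a b, |q₁ z - (q₁ x + q₂ x * (z - x))| ≤ M * |z - x| ^ 2 := by
    intro z hz
    refine abs_le_pow_succ_of_deriv (F := fun z => q₁ z - (q₁ x + q₂ x * (z - x)))
      (F' := fun z => q₂ z - q₂ x) hM0 (fun z hz => ?_) b2 hx (by simp) hz
    refine ((h₁ z hz).fun_sub (((hid z).const_mul (q₂ x)).const_add (q₁ x))).congr_deriv ?_
    rw [mul_one]
  refine abs_le_pow_succ_of_deriv
    (F := fun z => q₀ z - (q₀ x + q₁ x * (z - x) + q₂ x * (z - x) ^ 2 / 2))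
    (F' := fun z => q₁ z - (q₁ x + q₂ x * (z - x))) hM0 (fun z hz => ?_) b1 hx (by simp) hy
  refine ((h₀ z hz).fun_sub ((((hid z).const_mul (q₁ x)).const_add (q₀ x)).fun_add
    ((((hid z).pow 2).const_mul (q₂ x)).div_const 2))).congr_deriv ?_
  simp
  ring

lemma taylor_three_error {q₀ q₁ q₂ q₃ q₄ : ℝ → ℝ} {a b M : ℝ}
    (h₀ : ∀ z ∈ Set.Icc a b, HasDerivWithinAt q₀ (q₁ z) (Set.Icc a b) z)
    (h₁ : ∀ z ∈ Set.Icc a b, HasDerivWithinAt q₁ (q₂ z) (Set.Icc a b) z)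
    (h₂ : ∀ z ∈ Set.Icc a b, HasDerivWithinAt q₂ (q₃ z) (Set.Icc a b) z)
    (h₃ : ∀ z ∈ Set.Icc a b, HasDerivWithinAt q₃ (q₄ z) (Set.Icc a b) z)
    (hM : ∀ z ∈ Set.Icc a b, |q₄ z| ≤ M) {x y : ℝ} (hx : x ∈ Set.Icc a b) (hy : y ∈ Set.Icc a b) :
    |q₀ y - (q₀ x + q₁ x * (y - x) + q₂ x * (y - x) ^ 2 / 2 + q₃ x * (y - x) ^ 3 / 6)| ≤
      M * |y - x| ^ 4 := by
  have hM0 : 0 ≤ M := (abs_nonneg _).trans (hM x hx)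
  have hid : ∀ z, HasDerivWithinAt (fun z => z - x) 1 (Set.Icc a b) z := fun z =>
    (hasDerivWithinAt_id z _).sub_const x
  refine abs_le_pow_succ_of_deriv
    (F := fun z => q₀ z - (q₀ x + q₁ x * (z - x) + q₂ x * (z - x) ^ 2 / 2 +
      q₃ x * (z - x) ^ 3 / 6))
    (F' := fun z => q₁ z - (q₁ x + q₂ x * (z - x) + q₃ x * (z - x) ^ 2 / 2)) hM0
    (fun z hz => ?_) (fun z hz => taylor_two_error h₁ h₂ h₃ hM hx hz) hx (by simp) hy
  refine ((h₀ z hz).fun_sub (((((hid z).const_mul (q₁ x)).const_add (q₀ x)).fun_add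
    ((((hid z).pow 2).const_mul (q₂ x)).div_const 2)).fun_add
    ((((hid z).pow 3).const_mul (q₃ x)).div_const 6))).congr_deriv ?_
  simp
  ring

lemma second_difference_error {q₀ q₁ q₂ q₃ q₄ : ℝ → ℝ} {a b M h : ℝ} (hh : 0 < h)
    (h₀ : ∀ z ∈ Set.Icc a b, HasDerivWithinAt q₀ (q₁ z) (Set.Icc a b) z)
    (h₁ : ∀ z ∈ Set.Icc a b, HasDerivWithinAt q₁ (q₂ z) (Set.Icc a b) z)
    (h₂ : ∀ z ∈ Set.Icc a b, HasDerivWithinAt q₂ (q₃ z) (Set.Icc a b) z)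
    (h₃ : ∀ z ∈ Set.Icc a b, HasDerivWithinAt q₃ (q₄ z) (Set.Icc a b) z)
    (hM : ∀ z ∈ Set.Icc a b, |q₄ z| ≤ M) {x : ℝ} (hx : x ∈ Set.Icc a b)
    (hl : x - h ∈ Set.Icc a b) (hr : x + h ∈ Set.Icc a b) :
    |((q₀ (x + h) - q₀ x) / h - (q₀ x - q₀ (x - h)) / h) / h - q₂ x| ≤ 2 * M * h ^ 2 := by
  have e1 := taylor_three_error h₀ h₁ h₂ h₃ hM hx hr
  have e2 := taylor_three_error h₀ h₁ h₂ h₃ hM hx hl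
  rw [add_sub_cancel_left, abs_of_pos hh] at e1
  rw [sub_sub_cancel_left, abs_neg, abs_of_pos hh] at e2
  rw [show ((q₀ (x + h) - q₀ x) / h - (q₀ x - q₀ (x - h)) / h) / h - q₂ x =
    ((q₀ (x + h) - (q₀ x + q₁ x * h + q₂ x * h ^ 2 / 2 + q₃ x * h ^ 3 / 6)) +
    (q₀ (x - h) - (q₀ x + q₁ x * -h + q₂ x * (-h) ^ 2 / 2 + q₃ x * (-h) ^ 3 / 6))) / h ^ 2 by
      field_simp; ring, abs_div, abs_of_pos (pow_pos hh 2), div_le_iff₀ (pow_pos hh 2)]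
  refine (abs_add_le _ _).trans ((add_le_add e1 e2).trans (le_of_eq ?_))
  ring

/-- The step may be negative, which serves the right end point. The term `h / 2 * q₂ x` is kept
because the differential equation at the end point cancels it. -/
lemma one_sided_difference_error {q₀ q₁ q₂ q₃ : ℝ → ℝ} {a b M h : ℝ} (hh : h ≠ 0)
    (h₀ : ∀ z ∈ Set.Icc a b, HasDerivWithinAt q₀ (q₁ z) (Set.Icc a b) z)
    (h₁ : ∀ z ∈ Set.Icc a b, HasDerivWithinAt q₁ (q₂ z) (Set.Icc a b) z)
    (h₂ : ∀ z ∈ Set.Icc a b, HasDerivWithinAt q₂ (q₃ z) (Set.Icc a b) z)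
    (hM : ∀ z ∈ Set.Icc a b, |q₃ z| ≤ M) {x : ℝ} (hx : x ∈ Set.Icc a b)
    (hr : x + h ∈ Set.Icc a b) :
    |(q₀ (x + h) - q₀ x) / h - (q₁ x + h / 2 * q₂ x)| ≤ M * h ^ 2 := by
  have e1 := taylor_two_error h₀ h₁ h₂ hM hx hr
  rw [add_sub_cancel_left] at e1
  rw [show (q₀ (x + h) - q₀ x) / h - (q₁ x + h / 2 * q₂ x) =
    (q₀ (x + h) - (q₀ x + q₁ x * h + q₂ x * h ^ 2 / 2)) / h by field_simp; ring, abs_div,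
    div_le_iff₀ (abs_pos.mpr hh)]
  refine e1.trans (le_of_eq ?_)
  rw [← sq_abs h]
  ring

/-! ### Discrete energy identity, Sobolev inequality and stability. -/

/-- The trapezoidal sum of `z 0, …, z N` with step `h`. -/
def trapezoid (h : ℝ) (N : ℕ) (z : ℕ → ℝ) : ℝ :=
  ∑ i ∈ Finset.range N, h / 2 * (z i + z (i + 1))

lemma trapezoid_succ (h : ℝ) (K : ℕ) (z : ℕ → ℝ) :
    trapezoid h (K + 1) z =
      h / 2 * z 0 + h * ∑ i ∈ Finset.range K, z (i + 1) + h / 2 * z (K + 1) := by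
  induction K with
  | zero => simp [trapezoid]; ring
  | succ K ih =>
    rw [trapezoid, Finset.sum_range_succ, ← trapezoid, ih, Finset.sum_range_succ]
    ring

lemma trapezoid_mono {h : ℝ} (hh : 0 ≤ h) {N : ℕ} {z z' : ℕ → ℝ} (hz : ∀ i ≤ N, z i ≤ z' i) :
    trapezoid h N z ≤ trapezoid h N z' := by
  refine Finset.sum_le_sum fun i hi => ?_
  have hi := Finset.mem_range.mp hi
  have := hz i hi.le
  have := hz (i + 1) hi
  gcongr

lemma trapezoid_sum (h : ℝ) (N : ℕ) (s : Finset ℕ) (z : ℕ → ℕ → ℝ) :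
    ∑ k ∈ s, trapezoid h N (fun i => z i k) = trapezoid h N fun i => ∑ k ∈ s, z i k := by
  unfold trapezoid
  rw [Finset.sum_comm]
  simp only [← Finset.mul_sum, Finset.sum_add_distrib]

lemma trapezoid_const_mul (h c : ℝ) (N : ℕ) (z : ℕ → ℝ) :
    trapezoid h N (fun i => c * z i) = c * trapezoid h N z := by
  unfold trapezoid
  rw [Finset.mul_sum]
  exact Finset.sum_congr rfl fun i _ => by ring

/-- The squared discrete `H¹` seminorm. -/
def gradSq (h : ℝ) (N : ℕ) (a : ℕ → ℝ) : ℝ :=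
  ∑ i ∈ Finset.range N, h * ((a (i + 1) - a i) / h) ^ 2

lemma summation_by_parts (c a : ℕ → ℝ) (K : ℕ) :
    ∑ i ∈ Finset.range K, (c (i + 1) - c i) * a (i + 1) =
      c K * a (K + 1) - c 0 * a 0 - ∑ i ∈ Finset.range (K + 1), c i * (a (i + 1) - a i) := by
  induction K with
  | zero => simp; ring
  | succ K ih =>
    rw [Finset.sum_range_succ, ih, Finset.sum_range_succ _ (K + 1)]
    ring

/-- The energy identity of the semidiscrete problem at one time level. -/
lemma energy_identity {h : ℝ} (hh : 0 < h) (K : ℕ) (a D R : ℕ → ℝ) {q₀ q₁ r₀ r₁ : ℝ}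
    (hint : ∀ i < K, D (i + 1) =
      ((a (i + 2) - a (i + 1)) / h - (a (i + 1) - a i) / h) / h + R (i + 1))
    (hl : h / 2 * D 0 = (a 1 - a 0) / h - q₀ + r₀)
    (hr : h / 2 * D (K + 1) = -((a (K + 1) - a K) / h) - q₁ + r₁) :
    trapezoid h (K + 1) (fun i => D i * a i) + gradSq h (K + 1) a + q₀ * a 0 + q₁ * a (K + 1) =
      r₀ * a 0 + r₁ * a (K + 1) + h * ∑ i ∈ Finset.range K, R (i + 1) * a (i + 1) := by
  have hs : h * ∑ i ∈ Finset.range K, D (i + 1) * a (i + 1) =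
      ∑ i ∈ Finset.range K, ((a (i + 1 + 1) - a (i + 1)) / h - (a (i + 1) - a i) / h) * a (i + 1) +
        h * ∑ i ∈ Finset.range K, R (i + 1) * a (i + 1) := by
    rw [Finset.mul_sum, Finset.mul_sum, ← Finset.sum_add_distrib]
    refine Finset.sum_congr rfl fun i hi => ?_
    rw [hint i (Finset.mem_range.mp hi)]
    field_simp
  have hg : gradSq h (K + 1) a =
      ∑ i ∈ Finset.range (K + 1), (a (i + 1) - a i) / h * (a (i + 1) - a i) := by
    refine Finset.sum_congr rfl fun i _ => ?_
    field_simp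
  have hp := summation_by_parts (fun i => (a (i + 1) - a i) / h) a K
  rw [trapezoid_succ, hs, hp, hg]
  linear_combination a 0 * hl + a (K + 1) * hr

/-- A value of `a ^ 2` exceeds its trapezoidal mean by at most its total variation, and Young's
inequality with parameter `θ` bounds the variation by gradient and mass. -/
lemma discrete_sobolev {h θ : ℝ} (hh : 0 < h) (hθ : 0 < θ) {N : ℕ} (hN : 1 ≤ N) (a : ℕ → ℝ)
    {j : ℕ} (hj : j ≤ N) :
    a j ^ 2 ≤ θ * gradSq h N a + (1 / θ + 1 / (N * h)) * trapezoid h N (fun i => a i ^ 2) := by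
  set A := trapezoid h N (fun i => a i ^ 2) with hA
  set B := gradSq h N a with hB
  have hvar : ∑ i ∈ Finset.range N, |a (i + 1) ^ 2 - a i ^ 2| ≤ θ * B + 1 / θ * A := by
    rw [hA, hB, trapezoid, gradSq, Finset.mul_sum, Finset.mul_sum, ← Finset.sum_add_distrib]
    refine Finset.sum_le_sum fun i _ => ?_
    set x := a i
    set y := a (i + 1)
    set δ := (y - x) / h with hδ
    have hyx : y - x = h * δ := by rw [hδ]; field_simp
    have e : y ^ 2 - x ^ 2 = h * (δ * (y + x)) := by
      rw [show y ^ 2 - x ^ 2 = (y - x) * (y + x) by ring, hyx]; ring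
    have key : |δ * (y + x)| ≤ θ * δ ^ 2 + 1 / θ * ((x ^ 2 + y ^ 2) / 2) := by
      have h1 : 0 ≤ (θ * δ - (y + x) / 2) ^ 2 / θ := by positivity
      have h2 : 0 ≤ (θ * δ + (y + x) / 2) ^ 2 / θ := by positivity
      have h3 : 0 ≤ (y - x) ^ 2 / (4 * θ) := by positivity
      rw [show (θ * δ - (y + x) / 2) ^ 2 / θ =
        θ * δ ^ 2 - δ * (y + x) + 1 / θ * ((y + x) ^ 2 / 4) by field_simp; ring] at h1
      rw [show (θ * δ + (y + x) / 2) ^ 2 / θ =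
        θ * δ ^ 2 + δ * (y + x) + 1 / θ * ((y + x) ^ 2 / 4) by field_simp; ring] at h2
      have h4 : 1 / θ * ((y + x) ^ 2 / 4) + (y - x) ^ 2 / (4 * θ) =
        1 / θ * ((x ^ 2 + y ^ 2) / 2) := by field_simp; ring
      rw [abs_le]
      constructor <;> linarith
    rw [e, abs_mul, abs_of_pos hh]
    refine (mul_le_mul_of_nonneg_left key hh.le).trans (le_of_eq ?_)
    ring
  have hdist : ∀ i ≤ N, a j ^ 2 - (θ * B + 1 / θ * A) ≤ a i ^ 2 := by
    have gen : ∀ p q : ℕ, p ≤ q → q ≤ N → |a p ^ 2 - a q ^ 2| ≤ θ * B + 1 / θ * A := by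
      intro p q hpq hq
      have h1 := dist_le_Ico_sum_dist (fun i => a i ^ 2) hpq
      refine (h1.trans ?_).trans hvar
      simp only [Real.dist_eq]
      rw [Finset.sum_congr rfl fun i _ => abs_sub_comm (a i ^ 2) (a (i + 1) ^ 2)]
      refine Finset.sum_le_sum_of_subset_of_nonneg ?_ fun _ _ _ => abs_nonneg _
      intro i hi
      have := Finset.mem_Ico.mp hi
      exact Finset.mem_range.mpr (by omega)
    intro i hi
    rcases le_total i j with hij | hij
    · have := abs_le.mp (gen i j hij hj)
      linarith
    · have := abs_le.mp (gen j i hij hi)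
      linarith
  have hsum := trapezoid_mono hh.le hdist
  have hconst : trapezoid h N (fun _ => a j ^ 2 - (θ * B + 1 / θ * A)) =
      N * h * (a j ^ 2 - (θ * B + 1 / θ * A)) := by
    simp [trapezoid]; ring
  rw [hconst] at hsum
  have hNh : 0 < N * h := mul_pos (by exact_mod_cast hN) hh
  have : a j ^ 2 - (θ * B + 1 / θ * A) ≤ A / (N * h) := by
    rw [le_div_iff₀ hNh]; linarith
  calc a j ^ 2 ≤ θ * B + 1 / θ * A + A / (N * h) := by linarith
    _ = _ := by ring

lemma young_mul_le {x y c : ℝ} (hc : 0 < c) : x * y ≤ c * y ^ 2 + x ^ 2 / (4 * c) := by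
  have h : 0 ≤ (2 * c * y - x) ^ 2 / (4 * c) := by positivity
  rw [show (2 * c * y - x) ^ 2 / (4 * c) = c * y ^ 2 - x * y + x ^ 2 / (4 * c) by
    field_simp; ring] at h
  linarith

/-- Energy estimate for the fully discrete problem: `D` and `Q₀`, `Q₁` are coercive in time. -/
lemma discrete_stability {h μ ν ρ : ℝ} (hh : 0 < h) (hμ : 0 < μ) (hν : 0 < ν) (K n : ℕ)
    (e D R : ℕ → ℕ → ℝ) (Q₀ Q₁ r₀ r₁ : ℕ → ℝ)
    (hD : ∀ i ≤ K + 1, μ / 2 * ∑ k ∈ Finset.range n, e i k ^ 2 ≤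
      ∑ k ∈ Finset.range n, D i k * e i k)
    (hQ₀ : ν / 2 * ∑ k ∈ Finset.range n, e 0 k ^ 2 ≤ ∑ k ∈ Finset.range n, Q₀ k * e 0 k)
    (hQ₁ : ν / 2 * ∑ k ∈ Finset.range n, e (K + 1) k ^ 2 ≤
      ∑ k ∈ Finset.range n, Q₁ k * e (K + 1) k)
    (hint : ∀ k < n, ∀ i < K, D (i + 1) k =
      ((e (i + 2) k - e (i + 1) k) / h - (e (i + 1) k - e i k) / h) / h + R (i + 1) k)
    (hl : ∀ k < n, h / 2 * D 0 k = (e 1 k - e 0 k) / h - Q₀ k + r₀ k)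
    (hr : ∀ k < n, h / 2 * D (K + 1) k = -((e (K + 1) k - e K k) / h) - Q₁ k + r₁ k)
    (hR : ∀ k < n, ∀ i < K, |R (i + 1) k| ≤ ρ) (hr₀ : ∀ k < n, |r₀ k| ≤ ρ)
    (hr₁ : ∀ k < n, |r₁ k| ≤ ρ) :
    ∑ k ∈ Finset.range n, (gradSq h (K + 1) (fun i => e i k) +
        μ / 4 * trapezoid h (K + 1) (fun i => e i k ^ 2)) ≤
      n * (ρ ^ 2 * (1 / ν + (K + 1 : ℕ) * h / μ)) := by
  have hen : ∑ k ∈ Finset.range n, (trapezoid h (K + 1) (fun i => D i k * e i k) +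
      gradSq h (K + 1) (fun i => e i k) + Q₀ k * e 0 k + Q₁ k * e (K + 1) k) ≤
      ∑ k ∈ Finset.range n, (ν / 2 * e 0 k ^ 2 + ν / 2 * e (K + 1) k ^ 2 +
        μ / 4 * trapezoid h (K + 1) (fun i => e i k ^ 2) +
        ρ ^ 2 * (1 / ν + (K + 1 : ℕ) * h / μ)) := by
    refine Finset.sum_le_sum fun k hk => ?_
    have hk := Finset.mem_range.mp hk
    rw [energy_identity hh K (fun i => e i k) (fun i => D i k) (fun i => R i k)
      (hint k hk) (hl k hk) (hr k hk)]
    have sqle : ∀ {x : ℝ}, |x| ≤ ρ → x ^ 2 ≤ ρ ^ 2 := fun hx => sq_le_sq' (abs_le.mp hx).1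
      (abs_le.mp hx).2
    have y : ∀ {x z c : ℝ}, 0 < c → |x| ≤ ρ → x * z ≤ c * z ^ 2 + ρ ^ 2 / (4 * c) := by
      intro x z c hc hx
      refine (young_mul_le hc).trans ?_
      have := sqle hx
      gcongr
    -- The two boundary terms use up the whole coercivity `ν / 2`; the interior terms use `μ / 4`,
    -- half of the available `μ / 2`.
    have y0 := y (z := e 0 k) (half_pos hν) (hr₀ k hk)
    have y1 := y (z := e (K + 1) k) (half_pos hν) (hr₁ k hk)
    have yi : ∑ i ∈ Finset.range K, R (i + 1) k * e (i + 1) k ≤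
        μ / 4 * ∑ i ∈ Finset.range K, e (i + 1) k ^ 2 + K * (ρ ^ 2 / μ) := by
      rw [Finset.mul_sum, ← nsmul_eq_mul, ← Finset.card_range K, ← Finset.sum_const,
        Finset.card_range, ← Finset.sum_add_distrib]
      refine Finset.sum_le_sum fun i hi => ?_
      have := y (z := e (i + 1) k) (show 0 < μ / 4 by positivity) (hR k hk i (Finset.mem_range.mp hi))
      rwa [show 4 * (μ / 4) = μ by ring] at this
    have yi' := mul_le_mul_of_nonneg_left yi hh.le
    have htr := trapezoid_succ h K (fun i => e i k ^ 2)
    have hpos : 0 ≤ μ / 4 * (h / 2 * e 0 k ^ 2 + h / 2 * e (K + 1) k ^ 2) := by positivity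
    have hρ : 0 ≤ h * (ρ ^ 2 / μ) := by positivity
    have hfin : ρ ^ 2 * (1 / ν + (K + 1 : ℕ) * h / μ) =
        ρ ^ 2 / (4 * (ν / 2)) + ρ ^ 2 / (4 * (ν / 2)) + h * (K * (ρ ^ 2 / μ)) +
          h * (ρ ^ 2 / μ) := by
      push_cast
      field_simp
      ring
    rw [htr, hfin]
    linarith
  have hco : μ / 2 * ∑ k ∈ Finset.range n, trapezoid h (K + 1) (fun i => e i k ^ 2) ≤
      ∑ k ∈ Finset.range n, trapezoid h (K + 1) (fun i => D i k * e i k) := by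
    rw [trapezoid_sum h (K + 1) _ fun i k => e i k ^ 2,
      trapezoid_sum h (K + 1) _ fun i k => D i k * e i k, ← trapezoid_const_mul]
    exact trapezoid_mono hh.le hD
  simp only [Finset.sum_add_distrib, ← Finset.mul_sum, Finset.sum_const, Finset.card_range,
    nsmul_eq_mul] at hen hco ⊢
  linarith

/-- The maximum norm version of the energy estimate. -/
lemma sobolev_energy {h μ : ℝ} (hh : 0 < h) (hμ : 0 < μ) (K : ℕ) (a : ℕ → ℝ) {L : ℝ}
    (hL : L = (K + 1 : ℕ) * h) {j : ℕ} (hj : j ≤ K + 1) :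
    a j ^ 2 ≤ 2 * (1 + Real.sqrt (1 + L ^ 2 * μ)) / (L * μ) *
      (gradSq h (K + 1) a + μ / 4 * trapezoid h (K + 1) (fun i => a i ^ 2)) := by
  have hLpos : 0 < L := by rw [hL]; positivity
  set S := Real.sqrt (1 + L ^ 2 * μ) with hS
  have hS2 : S ^ 2 = 1 + L ^ 2 * μ := Real.sq_sqrt (by positivity)
  have hS0 : 0 ≤ S := Real.sqrt_nonneg _
  -- The positive root of `1 / θ + 1 / L = θ μ / 4`, which makes the Sobolev bound a multiple of the
  -- energy.
  set θ := 2 * (1 + S) / (L * μ) with hθdef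
  have hθ : 0 < θ := by positivity
  have key : 1 / θ + 1 / L = θ * (μ / 4) := by
    rw [hθdef]
    field_simp
    nlinarith
  have := discrete_sobolev hh hθ (Nat.succ_le_succ (Nat.zero_le K)) a hj
  rw [Nat.succ_eq_add_one, ← hL, key] at this
  linarith

/-! ### Regularity of the exact solution up to the boundary. -/

section Regularity

variable {xl xr T M : ℝ} {u : ℝ → ℝ → ℝ}

lemma IsC42.timeRegular (hT : 0 < T) (hu : IsC42 xl xr T u) (hM : C42NormLE xl xr T u M) {x : ℝ}
    (hx : x ∈ Set.Icc xl xr) : TimeRegular T M (fun t => u x t) (fun t => pdt T 1 u x t) := by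
  have hc := hu.contDiff_t x hx
  refine ⟨fun t ht => ?_, fun a ha b hb => ?_, fun t ht => ?_⟩
  · have := hasDerivWithinAt_iteratedDerivWithin (n := 2) hT hc (j := 0) (by norm_num) ht
    rwa [iteratedDerivWithin_zero] at this
  · exact (convex_Icc 0 T).norm_image_sub_le_of_norm_hasDerivWithin_le
      (fun t ht => hasDerivWithinAt_iteratedDerivWithin (n := 2) hT hc (j := 1) (by norm_num) ht)
      (fun t ht => (hM x hx t ht).2 2 le_rfl) hb ha
  · have := (hM x hx t ht).2 0 (by norm_num)
    rwa [pdt, iteratedDerivWithin_zero] at this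

lemma IsC42.hasDerivWithinAt_pdx (hx : xl < xr) (hu : IsC42 xl xr T u) {t : ℝ}
    (ht : t ∈ Set.Icc 0 T) {j : ℕ} (hj : j < 4) :
    ∀ z ∈ Set.Icc xl xr, HasDerivWithinAt (fun x => pdx xl xr j u x t) (pdx xl xr (j + 1) u z t)
      (Set.Icc xl xr) z := fun _ hz =>
  hasDerivWithinAt_iteratedDerivWithin (n := 4) hx (hu.contDiff_x t ht) hj hz

lemma pdx_zero (x t : ℝ) : pdx xl xr 0 u x t = u x t := by
  rw [pdx, iteratedDerivWithin_zero]

/-- Dominated convergence with the integrable majorant `M (t - s) ^ (-β)`. It extends the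
differential equation to the end points, where the scheme uses it too. -/
lemma IsC42.continuousOn_caputo (hT : 0 < T) (hu : IsC42 xl xr T u)
    (hM : C42NormLE xl xr T u M) {β t : ℝ} (hβ1 : β < 1) (ht : t ∈ Set.Ioc 0 T) :
    ContinuousOn (fun x => caputo β (fun s => u x s) t) (Set.Icc xl xr) := by
  have hsub : Set.Icc 0 t ⊆ Set.Icc 0 T := Set.Icc_subset_Icc le_rfl ht.2
  have hreg := fun x (hx : x ∈ Set.Icc xl xr) => hu.timeRegular hT hM hx
  have hcont : ContinuousOn (fun x => 1 / Real.Gamma (1 - β) *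
      ∫ s in (0 : ℝ)..t, pdt T 1 u x s / (t - s) ^ β) (Set.Icc xl xr) := by
    refine continuousOn_const.mul fun x₀ hx₀ => ?_
    refine intervalIntegral.continuousWithinAt_of_dominated_interval
      (bound := fun s => M * (1 / (t - s) ^ β)) ?_ ?_
      ((intervalIntegrable_inv_rpow_sub hβ1 ht.1.le).const_mul M) ?_
    · filter_upwards [self_mem_nhdsWithin] with x hx
      exact (intervalIntegrable_iff.mp (intervalIntegrable_div_rpow_sub hβ1 ht.1.le
        ((hreg x hx).continuousOn_deriv.mono hsub))).aestronglyMeasurable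
    · filter_upwards [self_mem_nhdsWithin] with x hx
      refine Filter.Eventually.of_forall fun s hs => ?_
      rw [Set.uIoc_of_le ht.1.le] at hs
      have hp : 0 ≤ (t - s) ^ β := Real.rpow_nonneg (by linarith [hs.2]) _
      rw [Real.norm_eq_abs, abs_div, abs_of_nonneg hp, mul_one_div]
      exact div_le_div_of_nonneg_right ((hM x hx s (hsub ⟨hs.1.le, hs.2⟩)).2 1 (by norm_num)) hp
    · refine Filter.Eventually.of_forall fun s hs => ?_
      rw [Set.uIoc_of_le ht.1.le] at hs
      have h1 : ContinuousOn (fun x => pdt T 1 u x s) (Set.Icc xl xr) :=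
        (hu.continuous_t 1 (by norm_num)).comp (f := fun x => (x, s))
          (by fun_prop) fun x hx => ⟨hx, hsub ⟨hs.1.le, hs.2⟩⟩
      exact (h1 x₀ hx₀).div_const _
  exact hcont.congr fun x hx => (hreg x hx).caputo_eq ht.1.le ht.2

lemma eqOn_Icc_of_eqOn_Ioo {a b : ℝ} (hab : a < b) {φ ψ : ℝ → ℝ}
    (hφ : ContinuousOn φ (Set.Icc a b)) (hψ : ContinuousOn ψ (Set.Icc a b))
    (h : Set.EqOn φ ψ (Set.Ioo a b)) : Set.EqOn φ ψ (Set.Icc a b) :=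
  h.of_subset_closure hφ hψ Set.Ioo_subset_Icc_self (closure_Ioo hab.ne).ge

lemma IsSolution.equation_Icc {α : ℝ} {f : ℝ → ℝ → ℝ} {u₀ : ℝ → ℝ} (hx : xl < xr) (hT : 0 < T)
    (hα1 : α < 1) (hu : IsC42 xl xr T u) (hM : C42NormLE xl xr T u M)
    (hs : IsSolution xl xr T α f u₀ u) {t : ℝ} (ht : t ∈ Set.Ioc 0 T) :
    ∀ x ∈ Set.Icc xl xr, caputo α (fun s => u x s) t = pdx xl xr 2 u x t + f x t := by
  have ht' : t ∈ Set.Icc 0 T := ⟨ht.1.le, ht.2⟩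
  refine eqOn_Icc_of_eqOn_Ioo hx (hu.continuousOn_caputo hT hM hα1 ht)
    (ContinuousOn.add (fun z hz => ?_) (hs.source_continuous t ht))
    fun x hx => hs.equation x hx t ht
  exact (hu.hasDerivWithinAt_pdx hx ht' (j := 2) (by norm_num) z hz).continuousWithinAt

lemma IsSolution.initial_Icc {α : ℝ} {f : ℝ → ℝ → ℝ} {u₀ : ℝ → ℝ} (hx : xl < xr) (hT : 0 < T)
    (hu : IsC42 xl xr T u) (hs : IsSolution xl xr T α f u₀ u) :
    ∀ x ∈ Set.Icc xl xr, u x 0 = u₀ x :=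
  eqOn_Icc_of_eqOn_Ioo hx (hu.contDiff_x 0 ⟨le_rfl, hT.le⟩).continuousOn hs.initial_continuous
    hs.initial

end Regularity

/-! ### Residuals of the scheme. -/

/-- The constant in the bound of the truncation error. -/
def truncConst (xl xr T M : ℝ) : ℝ := (|M| + 1) * (4 + 4 * T + (xr - xl) * (3 + T))

lemma truncConst_pos {xl xr T : ℝ} (M : ℝ) (hx : xl < xr) (hT : 0 < T) :
    0 < truncConst xl xr T M := by
  have : 0 < xr - xl := sub_pos.mpr hx
  unfold truncConst
  positivity

/-- Bounds the boundary error by the interior order; the factor `1 + T` covers time steps larger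
than `1`, uniformly in `α`. -/
lemma rpow_half_order_le {dt T α : ℝ} (hdt : 0 < dt) (hdT : dt ≤ T) (hα : 0 < α) (hα1 : α < 1) :
    dt ^ (2 - α / 2) ≤ (1 + T) * dt ^ (2 - α) := by
  have h1 : dt ^ (α / 2) ≤ 1 + T :=
    calc dt ^ (α / 2) ≤ (1 + T) ^ (α / 2) :=
          Real.rpow_le_rpow hdt.le (by linarith) (by linarith)
      _ ≤ (1 + T) ^ (1 : ℝ) := Real.rpow_le_rpow_of_exponent_le (by linarith) (by linarith)
      _ = 1 + T := Real.rpow_one _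
  rw [show 2 - α / 2 = α / 2 + (2 - α) by ring, Real.rpow_add hdt]
  exact mul_le_mul_of_nonneg_right h1 (Real.rpow_nonneg hdt.le _)

/-- The error of the numerical solution at the grid points. -/
def gridError (xl dt h : ℝ) (u : ℝ → ℝ → ℝ) (U : ℕ → ℕ → ℝ) (i k : ℕ) : ℝ :=
  U i k - u (xl + i * h) (k * dt)

/-- The uniform grid with `NT` time steps on `[0, T]` and `K + 1` space steps on `[xl, xr]`. -/
structure IsGrid (xl xr T dt h : ℝ) (NT K : ℕ) : Prop where
  interval : xl < xr
  time_pos : 0 < T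
  dt_eq : dt = T / NT
  dt_pos : 0 < dt
  h_eq : h = (xr - xl) / (K + 1 : ℕ)
  h_pos : 0 < h
  end_eq : xl + (K + 1 : ℕ) * h = xr
  time_le : ∀ k ≤ NT, (k : ℝ) * dt ≤ T

namespace IsGrid

variable {xl xr T dt h : ℝ} {NT K : ℕ}

lemma mk_of_steps (hx : xl < xr) (hT : 0 < T) (hNT : 1 ≤ NT) :
    IsGrid xl xr T (T / NT) ((xr - xl) / (K + 1 : ℕ)) NT K := by
  have hN : (0 : ℝ) < NT := by exact_mod_cast hNT
  have hK : (0 : ℝ) < (K + 1 : ℕ) := by positivity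
  refine ⟨hx, hT, rfl, by positivity, rfl, div_pos (sub_pos.mpr hx) hK, ?_, fun k hk => ?_⟩
  · rw [mul_div_cancel₀ _ hK.ne']
    ring
  · have : (k : ℝ) ≤ NT := by exact_mod_cast hk
    rw [← mul_div_assoc, div_le_iff₀ hN, mul_comm]
    exact mul_le_mul_of_nonneg_left this hT.le

lemma mem (G : IsGrid xl xr T dt h NT K) {i : ℕ} (hi : i ≤ K + 1) :
    xl + i * h ∈ Set.Icc xl xr := by
  have h1 : (i : ℝ) ≤ (K + 1 : ℕ) := by exact_mod_cast hi
  have h2 := mul_le_mul_of_nonneg_right h1 G.h_pos.le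
  have h3 : 0 ≤ (i : ℝ) * h := mul_nonneg (Nat.cast_nonneg i) G.h_pos.le
  have h4 := G.end_eq
  constructor <;> linarith

lemma time_mem (G : IsGrid xl xr T dt h NT K) {k : ℕ} (hk : k + 1 ≤ NT) :
    ((k + 1 : ℕ) : ℝ) * dt ∈ Set.Ioc 0 T :=
  ⟨mul_pos (by positivity) G.dt_pos, G.time_le _ hk⟩

lemma h_le (G : IsGrid xl xr T dt h NT K) : h ≤ xr - xl := by
  have h1 : 0 ≤ (K : ℝ) * h := mul_nonneg (Nat.cast_nonneg K) G.h_pos.le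
  have h2 := G.end_eq
  push_cast at h2
  linarith

lemma dt_le (G : IsGrid xl xr T dt h NT K) {k : ℕ} (hk : k + 1 ≤ NT) : dt ≤ T := by
  have := G.time_le 1 (by omega)
  simpa using this

end IsGrid

section TruncationConstant

variable {xl xr T M h a b c : ℝ}

/-- In the applications `a`, `b`, `c` are `dt ^ (2 - α)`, `h ^ 2` and `α * ε`. -/
lemma le_truncConst_mul (hx : xl < xr) (hT : 0 < T) (hM : 0 ≤ M) (ha : 0 ≤ a) (hb : 0 ≤ b)
    (hc : 0 ≤ c) {X : ℝ} (hX : X ≤ (4 + 4 * T + (xr - xl) * (3 + T)) * (a + b + c)) :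
    M * X ≤ truncConst xl xr T M * (a + b + c) := by
  have hL : 0 < xr - xl := sub_pos.mpr hx
  have h1 : M ≤ |M| + 1 := by linarith [le_abs_self M]
  rw [truncConst, mul_assoc]
  refine (mul_le_mul_of_nonneg_left hX hM).trans (mul_le_mul_of_nonneg_right h1 ?_)
  positivity

lemma interior_bound_le (hx : xl < xr) (hT : 0 < T) (hM : 0 ≤ M) (ha : 0 ≤ a) (hb : 0 ≤ b)
    (hc : 0 ≤ c) :
    2 * M * b + M * (3 * a + T * c) ≤ truncConst xl xr T M * (a + b + c) := by
  have hL : 0 < xr - xl := sub_pos.mpr hx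
  rw [show 2 * M * b + M * (3 * a + T * c) = M * (2 * b + 3 * a + T * c) by ring]
  refine le_truncConst_mul hx hT hM ha hb hc ?_
  have : 0 ≤ (1 + 4 * T + (xr - xl) * (3 + T)) * a + (2 + 4 * T + (xr - xl) * (3 + T)) * b +
      (4 + 3 * T + (xr - xl) * (3 + T)) * c := by positivity
  linarith

lemma boundary_bound_le (hx : xl < xr) (hT : 0 < T) (hM : 0 ≤ M) (hhL : h ≤ xr - xl)
    (ha : 0 ≤ a) (hb : 0 ≤ b) (hc : 0 ≤ c) :
    M * b + M * (3 * ((1 + T) * a) + T * c) + h / 2 * (M * (3 * a + T * c)) ≤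
      truncConst xl xr T M * (a + b + c) := by
  have hL : 0 < xr - xl := sub_pos.mpr hx
  rw [show M * b + M * (3 * ((1 + T) * a) + T * c) + h / 2 * (M * (3 * a + T * c)) =
    M * (b + (3 * ((1 + T) * a) + T * c) + h / 2 * (3 * a + T * c)) by ring]
  refine le_truncConst_mul hx hT hM ha hb hc ?_
  have h1 : h / 2 * (3 * a + T * c) ≤ (xr - xl) * (3 * a + T * c) :=
    mul_le_mul_of_nonneg_right (by linarith) (by positivity)
  have : 0 ≤ (1 + T + (xr - xl) * T) * a + (3 + 4 * T + (xr - xl) * (3 + T)) * b +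
      (4 + 3 * T + (xr - xl) * 3) * c := by positivity
  linarith

end TruncationConstant

namespace Setting

variable {xl xr T M α ε : ℝ} {u : ℝ → ℝ → ℝ} {NT K : ℕ} {U : ℕ → ℕ → ℝ} {dt h : ℝ}

lemma bound_nonneg (S : Setting xl xr T M α ε u NT (K + 1) U) (hx : xl < xr) (hT : 0 < T) :
    0 ≤ M :=
  (S.regular.timeRegular hT S.bounded (Set.left_mem_Icc.mpr hx.le)).nonneg hT.le

lemma eps_nonneg (S : Setting xl xr T M α ε u NT (K + 1) U) (hT : 0 < T) : 0 ≤ ε := by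
  refine S.sumOfExp.nonneg (div_le_self hT.le ?_)
  exact_mod_cast S.time_steps_pos

lemma gridError_zero (S : Setting xl xr T M α ε u NT (K + 1) U) (G : IsGrid xl xr T dt h NT K)
    {i : ℕ} (hi : i ≤ K + 1) : gridError xl dt h u U i 0 = 0 := by
  have h1 := S.numerical.initial i hi
  rw [← G.h_eq] at h1
  rw [gridError, h1, Nat.cast_zero, zero_mul,
    S.solution.initial_Icc G.interval G.time_pos S.regular _ (G.mem hi), sub_self]

lemma time_error (S : Setting xl xr T M α ε u NT (K + 1) U) (G : IsGrid xl xr T dt h NT K)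
    {k : ℕ} (hk : k + 1 ≤ NT) {x : ℝ} (hxm : x ∈ Set.Icc xl xr) :
    |firDeriv α dt S.w S.s (fun l => u x (l * dt)) (k + 1) -
        (pdx xl xr 2 u x ((k + 1 : ℕ) * dt) + S.f x ((k + 1 : ℕ) * dt))| ≤
      M * (3 * dt ^ (2 - α) + T * (α * ε)) := by
  rw [← S.solution.equation_Icc G.interval G.time_pos S.order_lt_one S.regular S.bounded
    (G.time_mem hk) x hxm]
  have hws := S.sumOfExp
  rw [← G.dt_eq] at hws
  exact (S.regular.timeRegular G.time_pos S.bounded hxm).firDeriv_error S.order_pos S.order_lt_one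
    G.dt_pos hws k (G.time_le _ hk)

lemma time_error_half (S : Setting xl xr T M α ε u NT (K + 1) U) (G : IsGrid xl xr T dt h NT K)
    {k : ℕ} (hk : k + 1 ≤ NT) {x : ℝ} (hxm : x ∈ Set.Icc xl xr) :
    |firDeriv (α / 2) dt S.w' S.s' (fun l => u x (l * dt)) (k + 1) -
        caputo (α / 2) (fun s => u x s) ((k + 1 : ℕ) * dt)| ≤
      M * (3 * ((1 + T) * dt ^ (2 - α)) + T * (α * ε)) := by
  have hws := S.sumOfExp_half
  rw [← G.dt_eq] at hws
  have hα := S.order_pos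
  have hα1 := S.order_lt_one
  have hT := G.time_pos
  have hε := S.eps_nonneg hT
  have hM := S.bound_nonneg G.interval hT
  refine ((S.regular.timeRegular hT S.bounded hxm).firDeriv_error (by linarith) (by linarith)
    G.dt_pos hws k (G.time_le _ hk)).trans ?_
  have h1 := rpow_half_order_le G.dt_pos (G.dt_le hk) hα hα1
  have h2 : α / 2 * ε ≤ α * ε := mul_le_mul_of_nonneg_right (by linarith) hε
  gcongr

lemma interior_residual (S : Setting xl xr T M α ε u NT (K + 1) U)
    (G : IsGrid xl xr T dt h NT K) {k : ℕ} (hk : k + 1 ≤ NT) {i : ℕ} (hi : i < K) :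
    |firDeriv α dt S.w S.s (gridError xl dt h u U (i + 1)) (k + 1) -
      ((gridError xl dt h u U (i + 2) (k + 1) - gridError xl dt h u U (i + 1) (k + 1)) / h -
        (gridError xl dt h u U (i + 1) (k + 1) - gridError xl dt h u U i (k + 1)) / h) / h| ≤
      truncConst xl xr T M * (dt ^ (2 - α) + h ^ 2 + α * ε) := by
  have hM := S.bound_nonneg G.interval G.time_pos
  have hm1 := G.mem (show i + 1 ≤ K + 1 by omega)
  have hm0 := G.mem (show i ≤ K + 1 by omega)
  have hm2 := G.mem (show i + 2 ≤ K + 1 by omega)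
  have e0 : xl + (i : ℕ) * h = xl + (i + 1 : ℕ) * h - h := by push_cast; ring
  have e2 : xl + (i + 2 : ℕ) * h = xl + (i + 1 : ℕ) * h + h := by push_cast; ring
  have ht := S.time_error G hk hm1
  have htm : ((k + 1 : ℕ) : ℝ) * dt ∈ Set.Icc 0 T := Set.Ioc_subset_Icc_self (G.time_mem hk)
  have hd := fun j (hj : j < 4) => S.regular.hasDerivWithinAt_pdx G.interval htm hj
  rw [e0] at hm0
  rw [e2] at hm2
  have hsp := second_difference_error G.h_pos (hd 0 (by norm_num)) (hd 1 (by norm_num))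
    (hd 2 (by norm_num)) (hd 3 (by norm_num))
    (fun z hz => (S.bounded z hz _ htm).1 4 le_rfl) hm1 hm0 hm2
  simp only [pdx_zero] at hsp
  have heq := S.numerical.interior (i + 1) (k + 1) (by omega) (by omega) (by omega) hk
  rw [← G.dt_eq, ← G.h_eq] at heq
  have hsub := firDeriv_sub α dt S.w S.s (U (i + 1)) (fun k => u (xl + (i + 1 : ℕ) * h) (k * dt))
    (k + 1)
  rw [show gridError xl dt h u U (i + 1) =
    fun k => U (i + 1) k - u (xl + (i + 1 : ℕ) * h) (k * dt) from rfl, hsub, heq]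
  simp only [gridError, Nat.add_sub_cancel]
  rw [e0, e2]
  refine le_trans ?_ (interior_bound_le G.interval G.time_pos hM
    (Real.rpow_nonneg G.dt_pos.le _) (sq_nonneg h)
    (mul_nonneg S.order_pos.le (S.eps_nonneg G.time_pos)))
  refine le_trans (le_of_eq ?_) ((abs_sub _ _).trans (add_le_add hsp ht))
  congr 1
  ring

lemma left_residual (S : Setting xl xr T M α ε u NT (K + 1) U)
    (G : IsGrid xl xr T dt h NT K) {k : ℕ} (hk : k + 1 ≤ NT) :
    |h / 2 * firDeriv α dt S.w S.s (gridError xl dt h u U 0) (k + 1) -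
      ((gridError xl dt h u U 1 (k + 1) - gridError xl dt h u U 0 (k + 1)) / h -
        firDeriv (α / 2) dt S.w' S.s' (gridError xl dt h u U 0) (k + 1))| ≤
      truncConst xl xr T M * (dt ^ (2 - α) + h ^ 2 + α * ε) := by
  have hM := S.bound_nonneg G.interval G.time_pos
  have hh := G.h_pos
  have hm0 : xl ∈ Set.Icc xl xr := Set.left_mem_Icc.mpr G.interval.le
  have e0 : xl + (0 : ℕ) * h = xl := by push_cast; ring
  have e1 : xl + (1 : ℕ) * h = xl + h := by push_cast; ring
  have hm1 := G.mem (show 1 ≤ K + 1 by omega)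
  rw [e1] at hm1
  have ht := S.time_error G hk hm0
  have ht' := S.time_error_half G hk hm0
  rw [← S.solution.left_boundary _ (G.time_mem hk)] at ht'
  have htm : ((k + 1 : ℕ) : ℝ) * dt ∈ Set.Icc 0 T := Set.Ioc_subset_Icc_self (G.time_mem hk)
  have hd := fun j (hj : j < 4) => S.regular.hasDerivWithinAt_pdx G.interval htm hj
  have hsp := one_sided_difference_error hh.ne' (hd 0 (by norm_num)) (hd 1 (by norm_num))
    (hd 2 (by norm_num)) (fun z hz => (S.bounded z hz _ htm).1 3 (by norm_num)) hm0 hm1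
  simp only [pdx_zero, zero_add, Nat.reduceAdd] at hsp
  have heq := S.numerical.left (k + 1) (by omega) hk
  rw [← G.dt_eq, ← G.h_eq] at heq
  have hsub := firDeriv_sub α dt S.w S.s (U 0) (fun k => u xl (k * dt)) (k + 1)
  have hsub' := firDeriv_sub (α / 2) dt S.w' S.s' (U 0) (fun k => u xl (k * dt)) (k + 1)
  have hge : gridError xl dt h u U 0 = fun k => U 0 k - u xl (k * dt) := by
    funext k
    rw [gridError, e0]
  rw [hge, hsub, hsub', heq]
  simp only [gridError]
  rw [e1]
  refine le_trans ?_ (boundary_bound_le G.interval G.time_pos hM G.h_le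
    (Real.rpow_nonneg G.dt_pos.le _) (sq_nonneg h)
    (mul_nonneg S.order_pos.le (S.eps_nonneg G.time_pos)))
  have ht2 := mul_le_mul_of_nonneg_left ht (half_pos hh).le
  rw [← abs_of_pos (half_pos hh), ← abs_mul, abs_of_pos (half_pos hh)] at ht2
  -- Three errors remain: the one-sided difference, the half-order derivative, and `h / 2` times the
  -- time error. Here `u_x` cancels by the boundary condition, and `h / 2 * u_xx` and the source by
  -- the equation at `xl`.
  refine le_trans (le_of_eq ?_) ((abs_sub _ _).trans (add_le_add
    ((abs_sub _ _).trans (add_le_add hsp ht')) ht2))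
  congr 1
  field_simp
  ring

lemma right_residual (S : Setting xl xr T M α ε u NT (K + 1) U)
    (G : IsGrid xl xr T dt h NT K) {k : ℕ} (hk : k + 1 ≤ NT) :
    |h / 2 * firDeriv α dt S.w S.s (gridError xl dt h u U (K + 1)) (k + 1) -
      (-((gridError xl dt h u U (K + 1) (k + 1) - gridError xl dt h u U K (k + 1)) / h) -
        firDeriv (α / 2) dt S.w' S.s' (gridError xl dt h u U (K + 1)) (k + 1))| ≤
      truncConst xl xr T M * (dt ^ (2 - α) + h ^ 2 + α * ε) := by
  have hM := S.bound_nonneg G.interval G.time_pos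
  have hh := G.h_pos
  have hm0 : xr ∈ Set.Icc xl xr := Set.right_mem_Icc.mpr G.interval.le
  have e0 := G.end_eq
  have e1 : xl + (K : ℕ) * h = xr + -h := by rw [← e0]; push_cast; ring
  have hm1 := G.mem (show K ≤ K + 1 by omega)
  rw [e1] at hm1
  have ht := S.time_error G hk hm0
  have ht' := S.time_error_half G hk hm0
  have hbc := S.solution.right_boundary _ (G.time_mem hk)
  rw [show caputo (α / 2) (fun s => u xr s) (((k + 1 : ℕ) : ℝ) * dt) =
    -pdx xl xr 1 u xr (((k + 1 : ℕ) : ℝ) * dt) by rw [hbc, neg_neg]] at ht'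
  have htm : ((k + 1 : ℕ) : ℝ) * dt ∈ Set.Icc 0 T := Set.Ioc_subset_Icc_self (G.time_mem hk)
  have hd := fun j (hj : j < 4) => S.regular.hasDerivWithinAt_pdx G.interval htm hj
  have hsp := one_sided_difference_error (neg_ne_zero.mpr hh.ne') (hd 0 (by norm_num))
    (hd 1 (by norm_num)) (hd 2 (by norm_num))
    (fun z hz => (S.bounded z hz _ htm).1 3 (by norm_num)) hm0 hm1
  simp only [pdx_zero, zero_add, Nat.reduceAdd] at hsp
  -- With step `-h`, the quotient approximates `u_x - h / 2 * u_xx`, whereas the scheme contains its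
  -- negative.
  rw [neg_sq, ← abs_neg] at hsp
  have heq := S.numerical.right (k + 1) (by omega) hk
  rw [← G.dt_eq, ← G.h_eq, e0] at heq
  have hsub := firDeriv_sub α dt S.w S.s (U (K + 1)) (fun k => u xr (k * dt)) (k + 1)
  have hsub' := firDeriv_sub (α / 2) dt S.w' S.s' (U (K + 1)) (fun k => u xr (k * dt)) (k + 1)
  have hge : gridError xl dt h u U (K + 1) = fun k => U (K + 1) k - u xr (k * dt) := by
    funext k
    rw [gridError, e0]
  rw [hge, hsub, hsub', heq]
  simp only [gridError, Nat.add_sub_cancel]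
  rw [e1]
  refine le_trans ?_ (boundary_bound_le G.interval G.time_pos hM G.h_le
    (Real.rpow_nonneg G.dt_pos.le _) (sq_nonneg h)
    (mul_nonneg S.order_pos.le (S.eps_nonneg G.time_pos)))
  have ht2 := mul_le_mul_of_nonneg_left ht (half_pos hh).le
  rw [← abs_of_pos (half_pos hh), ← abs_mul, abs_of_pos (half_pos hh)] at ht2
  refine le_trans (le_of_eq ?_) ((abs_sub _ _).trans (add_le_add
    ((abs_sub _ _).trans (add_le_add hsp ht')) ht2))
  congr 1
  field_simp
  ring

/-! ### Error estimate in the energy and in the maximum norm. -/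

/-- The energy estimate for the error of the scheme. -/
lemma energy_error_le (S : Setting xl xr T M α ε u NT (K + 1) U) (G : IsGrid xl xr T dt h NT K)
    {n : ℕ} (hn : n + 1 ≤ NT) {μ ν : ℝ} (hμ : 0 < μ) (hν : 0 < ν)
    (hμn : μ ≤ mu α ε dt (n + 1)) (hνn : ν ≤ nu α ε dt (n + 1)) :
    ∑ k ∈ Finset.range (n + 1),
        (gradSq h (K + 1) (fun i => gridError xl dt h u U i (k + 1)) +
          μ / 4 * trapezoid h (K + 1) (fun i => gridError xl dt h u U i (k + 1) ^ 2)) ≤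
      (n + 1 : ℕ) * ((truncConst xl xr T M * (dt ^ (2 - α) + h ^ 2 + α * ε)) ^ 2 *
        (1 / ν + (K + 1 : ℕ) * h / μ)) := by
  have hα := S.order_pos
  have hα1 := S.order_lt_one
  have hws := S.sumOfExp
  have hws' := S.sumOfExp_half
  rw [← G.dt_eq] at hws hws'
  have hdt := G.dt_pos
  have htn := G.time_le _ hn
  have htpos : (0 : ℝ) < (n + 1 : ℕ) * dt := (G.time_mem hn).1
  have hcoer : ∀ {β : ℝ} {m : ℕ} {w s : Fin m → ℝ}, 0 < β → β < 1 → IsSumOfExp β ε dt T w s →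
      ∀ {c : ℝ}, c ≤ ((((n + 1 : ℕ) : ℝ) * dt) ^ (-β) - 2 * β * ε * (n * dt)) /
        Real.Gamma (1 - β) → ∀ i ≤ K + 1,
      c / 2 * ∑ k ∈ Finset.range (n + 1), gridError xl dt h u U i (k + 1) ^ 2 ≤
        ∑ k ∈ Finset.range (n + 1), firDeriv β dt w s (gridError xl dt h u U i) (k + 1) *
          gridError xl dt h u U i (k + 1) := by
    intro β m w s hβ hβ1 hws c hc i hi
    refine le_trans (mul_le_mul_of_nonneg_right ?_ (Finset.sum_nonneg fun _ _ => sq_nonneg _))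
      (firDeriv_coercive hβ hβ1 hdt hws _ (S.gridError_zero G hi) n htn)
    have hG : 0 < Real.Gamma (1 - β) := Real.Gamma_pos_of_pos (by linarith)
    have hp : 0 ≤ (((n + 1 : ℕ) : ℝ) * dt) ^ (-β) := Real.rpow_nonneg htpos.le _
    -- Half of `t ^ (-β) - 2 β ε t_n` is at most the coercivity constant `t ^ (-β) - β ε t_n`, since
    -- half of `t ^ (-β)` may be dropped.
    rw [le_div_iff₀ hG] at hc ⊢
    linarith
  have hn1 : ((n + 1 : ℕ) : ℝ) - 1 = n := by push_cast; ring
  rw [mu, hn1] at hμn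
  rw [nu, hn1, show α * ε * (n * dt) = 2 * (α / 2) * ε * (n * dt) by ring] at hνn
  have hlt : ∀ {k}, k < n + 1 → k + 1 ≤ NT := fun hk => by omega
  -- The residuals are defined as the defects of the error in the scheme, so the three equations
  -- hold trivially and only the bounds carry content. Times are shifted by one because level `0`
  -- has no equation.
  refine discrete_stability G.h_pos hμ hν K (n + 1) (fun i k => gridError xl dt h u U i (k + 1))
    (fun i k => firDeriv α dt S.w S.s (gridError xl dt h u U i) (k + 1))
    (fun i k => firDeriv α dt S.w S.s (gridError xl dt h u U i) (k + 1) -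
      ((gridError xl dt h u U (i + 1) (k + 1) - gridError xl dt h u U i (k + 1)) / h -
        (gridError xl dt h u U i (k + 1) - gridError xl dt h u U (i - 1) (k + 1)) / h) / h) _ _ _ _
    (hcoer hα hα1 hws hμn)
    (hcoer (by linarith) (by linarith) hws' hνn 0 (by omega))
    (hcoer (by linarith) (by linarith) hws' hνn (K + 1) le_rfl)
    (fun k hk i hi => (add_sub_cancel _ _).symm) (fun k hk => (add_sub_cancel _ _).symm)
    (fun k hk => (add_sub_cancel _ _).symm) ?_
    (fun k hk => S.left_residual G (hlt hk)) (fun k hk => S.right_residual G (hlt hk))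
  exact fun k hk i hi => S.interior_residual G (hlt hk) hi

end Setting

lemma sum_Icc_one_eq_range (F : ℕ → ℝ) (n : ℕ) :
    ∑ k ∈ Finset.Icc 1 n, F k = ∑ k ∈ Finset.range n, F (k + 1) := by
  rw [Finset.range_eq_Ico, Finset.sum_Ico_add' F 0 n 1]
  rfl

lemma errConst_pos {c₁ T L μ ν : ℝ} (hc : 0 < c₁) (hT : 0 < T) (hL : 0 < L) (hμ : 0 < μ)
    (hν : 0 < ν) : 0 < errConst c₁ T L μ ν :=
  Real.sqrt_pos.mpr (by positivity)

/-- The error estimate with lower bounds `μ`, `ν` for the coercivity constants. -/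
lemma Setting.globalError_le {xl xr T M α ε : ℝ} {u : ℝ → ℝ → ℝ} {NT NS : ℕ} {U : ℕ → ℕ → ℝ}
    (S : Setting xl xr T M α ε u NT NS U) (hx : xl < xr) (hT : 0 < T) {n : ℕ} (hn1 : 1 ≤ n)
    (hn : n ≤ NT) {μ ν : ℝ} (hμ : 0 < μ) (hν : 0 < ν) (hμn : μ ≤ mu α ε (T / NT) n)
    (hνn : ν ≤ nu α ε (T / NT) n) :
    globalError xl (T / NT) ((xr - xl) / NS) NS u U n ≤
      errConst (truncConst xl xr T M) T (xr - xl) μ ν *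
        ((T / NT) ^ (2 - α) + ((xr - xl) / NS) ^ 2 + α * ε) := by
  obtain ⟨n, rfl⟩ := Nat.exists_eq_add_of_le' hn1
  obtain ⟨K, rfl⟩ := Nat.exists_eq_add_of_le' S.space_steps_pos
  have G : IsGrid xl xr T (T / NT) ((xr - xl) / (K + 1 : ℕ)) NT K :=
    .mk_of_steps hx hT S.time_steps_pos
  have hE := S.energy_error_le G hn hμ hν hμn hνn
  have hLK : xr - xl = (K + 1 : ℕ) * ((xr - xl) / (K + 1 : ℕ)) := by linarith [G.end_eq]
  rw [← hLK] at hE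
  have hL : 0 < xr - xl := sub_pos.mpr hx
  have hc := truncConst_pos M hx hT
  have hdt := G.dt_pos
  have hτ : 0 ≤ (T / NT) ^ (2 - α) + ((xr - xl) / (K + 1 : ℕ)) ^ 2 + α * ε :=
    add_nonneg (add_nonneg (Real.rpow_nonneg hdt.le _) (sq_nonneg _))
      (mul_nonneg S.order_pos.le (S.eps_nonneg hT))
  have htn : (T / NT) * (n + 1 : ℕ) ≤ T := by linarith [G.time_le _ hn]
  have hsob := fun (a : ℕ → ℝ) (j : ℕ) (hj : j ≤ K + 1) =>
    sobolev_energy G.h_pos hμ K a hLK hj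
  have herr := errConst_pos hc hT hL hμ hν
  set c := truncConst xl xr T M
  set L := xr - xl
  set dt := T / NT
  set h := L / (K + 1 : ℕ)
  set τ := dt ^ (2 - α) + h ^ 2 + α * ε
  set θ := 2 * (1 + Real.sqrt (1 + L ^ 2 * μ)) / (L * μ) with hθdef
  have hθ : 0 < θ := by positivity
  rw [globalError, Real.sqrt_le_iff]
  refine ⟨mul_nonneg herr.le hτ, ?_⟩
  rw [sum_Icc_one_eq_range]
  have hnorm : ∀ k ∈ Finset.range (n + 1),
      ‖fun i : Fin (K + 1 + 1) => U i (k + 1) - u (xl + (i : ℕ) * h) ((k + 1 : ℕ) * dt)‖ ^ 2 ≤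
        θ * (gradSq h (K + 1) (fun i => gridError xl dt h u U i (k + 1)) +
          μ / 4 * trapezoid h (K + 1) (fun i => gridError xl dt h u U i (k + 1) ^ 2)) := by
    intro k _
    have hb := hsob fun i => gridError xl dt h u U i (k + 1)
    have hX := (sq_nonneg _).trans (hb 0 (Nat.zero_le _))
    rw [← Real.le_sqrt (norm_nonneg _) hX, pi_norm_le_iff_of_nonneg (Real.sqrt_nonneg _)]
    exact fun i => Real.abs_le_sqrt (hb i (Nat.lt_succ_iff.mp i.2))
  -- The energy argument needs only half of the square of `errConst`.
  have hsq : (errConst c T L μ ν * τ) ^ 2 = 2 * (θ * (T * ((c * τ) ^ 2 * (1 / ν + L / μ)))) := by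
    rw [mul_pow, errConst, Real.sq_sqrt (by positivity), hθdef]
    ring
  have hpos : 0 ≤ (c * τ) ^ 2 * (1 / ν + L / μ) := by positivity
  calc _ ≤ dt * ∑ k ∈ Finset.range (n + 1),
          θ * (gradSq h (K + 1) (fun i => gridError xl dt h u U i (k + 1)) +
          μ / 4 * trapezoid h (K + 1) (fun i => gridError xl dt h u U i (k + 1) ^ 2)) :=
        mul_le_mul_of_nonneg_left (Finset.sum_le_sum hnorm) hdt.le
    _ ≤ dt * (θ * ((n + 1 : ℕ) * ((c * τ) ^ 2 * (1 / ν + L / μ)))) := by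
        rw [← Finset.mul_sum]
        exact mul_le_mul_of_nonneg_left (mul_le_mul_of_nonneg_left hE hθ.le) hdt.le
    _ = θ * (dt * (n + 1 : ℕ) * ((c * τ) ^ 2 * (1 / ν + L / μ))) := by ring
    _ ≤ θ * (T * ((c * τ) ^ 2 * (1 / ν + L / μ))) :=
        mul_le_mul_of_nonneg_left (mul_le_mul_of_nonneg_right htn hpos) hθ.le
    _ ≤ (errConst c T L μ ν * τ) ^ 2 := by
        rw [hsq]
        have : 0 ≤ θ * (T * ((c * τ) ^ 2 * (1 / ν + L / μ))) := by positivity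
        linarith

/-- The power of `t_n` decreases and the subtracted term grows with `n`, so a lower bound at the
final time serves all earlier levels. -/
lemma mu_anti {α ε dt : ℝ} (hα : 0 < α) (hα1 : α < 1) (hε : 0 ≤ ε) (hdt : 0 < dt) {n N : ℕ}
    (hn : 1 ≤ n) (hnN : n ≤ N) : mu α ε dt N ≤ mu α ε dt n := by
  have hG : 0 < Real.Gamma (1 - α) := Real.Gamma_pos_of_pos (by linarith)
  have h1 : (n : ℝ) ≤ N := by exact_mod_cast hnN
  have hnpos : (0 : ℝ) < n := by exact_mod_cast hn
  have h2 : ((N : ℝ) * dt) ^ (-α) ≤ ((n : ℝ) * dt) ^ (-α) :=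
    Real.rpow_le_rpow_of_nonpos (by positivity) (by gcongr) (by linarith)
  unfold mu
  gcongr

lemma nu_anti {α ε dt : ℝ} (hα : 0 < α) (hα1 : α < 1) (hε : 0 ≤ ε) (hdt : 0 < dt) {n N : ℕ}
    (hn : 1 ≤ n) (hnN : n ≤ N) : nu α ε dt N ≤ nu α ε dt n := by
  have hG : 0 < Real.Gamma (1 - α / 2) := Real.Gamma_pos_of_pos (by linarith)
  have h1 : (n : ℝ) ≤ N := by exact_mod_cast hnN
  have hnpos : (0 : ℝ) < n := by exact_mod_cast hn
  have h2 : ((N : ℝ) * dt) ^ (-(α / 2)) ≤ ((n : ℝ) * dt) ^ (-(α / 2)) :=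
    Real.rpow_le_rpow_of_nonpos (by positivity) (by gcongr) (by linarith)
  unfold nu
  gcongr

end FIR

end

theorem mainTheorem2 (xl xr T M : ℝ) (hx : xl < xr) (hT : 0 < T) :
    -- the explicit constant: `c₁` depends on `xl`, `xr`, `T`, `M` only
    (∃ c₁ : ℝ, 0 < c₁ ∧
      ∀ (α ε : ℝ) (u : ℝ → ℝ → ℝ) (NT NS : ℕ) (U : ℕ → ℕ → ℝ),
        FIR.Setting xl xr T M α ε u NT NS U →
        ∀ n : ℕ, 1 ≤ n → n ≤ NT →
          0 < FIR.mu α ε (T / NT) n → 0 < FIR.nu α ε (T / NT) n →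
          0 < FIR.errConst c₁ T (xr - xl) (FIR.mu α ε (T / NT) n) (FIR.nu α ε (T / NT) n) ∧
          FIR.globalError xl (T / NT) ((xr - xl) / NS) NS u U n ≤
            FIR.errConst c₁ T (xr - xl) (FIR.mu α ε (T / NT) n) (FIR.nu α ε (T / NT) n) *
              ((T / NT) ^ (2 - α) + ((xr - xl) / NS) ^ 2 + α * ε)) ∧
    -- hence one constant `c₂` for all grids and all `n`, as long as `μ`, `ν` stay away from `0`
    (∀ μ₀ ν₀ : ℝ, 0 < μ₀ → 0 < ν₀ → ∃ c₂ : ℝ, 0 < c₂ ∧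
      ∀ (α ε : ℝ) (u : ℝ → ℝ → ℝ) (NT NS : ℕ) (U : ℕ → ℕ → ℝ),
        FIR.Setting xl xr T M α ε u NT NS U →
        μ₀ ≤ FIR.mu α ε (T / NT) NT → ν₀ ≤ FIR.nu α ε (T / NT) NT →
        ∀ n : ℕ, 1 ≤ n → n ≤ NT →
          FIR.globalError xl (T / NT) ((xr - xl) / NS) NS u U n ≤
            c₂ * ((T / NT) ^ (2 - α) + ((xr - xl) / NS) ^ 2 + α * ε)) := by
  have hc := FIR.truncConst_pos M hx hT
  have hL : 0 < xr - xl := sub_pos.mpr hx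
  refine ⟨⟨FIR.truncConst xl xr T M, hc, ?_⟩, fun μ₀ ν₀ hμ₀ hν₀ =>
    ⟨FIR.errConst (FIR.truncConst xl xr T M) T (xr - xl) μ₀ ν₀,
      FIR.errConst_pos hc hT hL hμ₀ hν₀, ?_⟩⟩
  · intro α ε u NT NS U S n hn1 hn hμ hν
    exact ⟨FIR.errConst_pos hc hT hL hμ hν,
      S.globalError_le hx hT hn1 hn hμ hν le_rfl le_rfl⟩
  · intro α ε u NT NS U S hμ hν n hn1 hn
    have hN : (1 : ℝ) ≤ NT := by exact_mod_cast S.time_steps_pos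
    have hε : 0 ≤ ε := S.sumOfExp.nonneg (div_le_self hT.le hN)
    have hdt : 0 < T / NT := div_pos hT (by linarith)
    -- The estimate accepts any positive lower bounds of `mu` and `nu`, so no monotonicity of
    -- `errConst` is needed.
    exact S.globalError_le hx hT hn1 hn hμ₀ hν₀
      (hμ.trans (FIR.mu_anti S.order_pos S.order_lt_one hε hdt hn1 hn))
      (hν.trans (FIR.nu_anti S.order_pos S.order_lt_one hε hdt hn1 hn))
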